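/- **Setting.** Let $\mathcal S,\mathcal A$ be finite non-empty sets, $P(\cdot\mid s,a)$ a transition kernel on $\mathcal S$, $\rho$ an initial distribution on $\mathcal S$, $\gamma\in[0,1)$, and $r(s,a;\theta)$, $\theta\in\mathbb R^p$, a family of rewards, differentiable in $\theta$, such that for all $s,a,\theta,\theta_1,\theta_2$ $$0\le r(s,a;\theta)\le C_r,\qquad \|\nabla_\theta r(s,a;\theta)\|\le L_r,\qquad \|\nabla_\theta r(s,a;\theta_1)-\nabla_\theta r(s,a;\theta_2)\|\le L_g\|\theta_1-\theta_2\|,$$ with constants $C_r,L_r,L_g>0$. A policy $\pi$ assigns to each state a distribution $\pi(\cdot\mid s)$ on $\mathcal A$; $\mathcal H$ denotes Shannon entropy, and a trajectory of $\pi$ is $\tau=(s_t,a_t)_{t\ge0}$ with $a_t\sim\pi(\cdot\mid s_t)$, $s_{t+1}\sim P(\cdot\mid s_t,a_t)$. The soft value and soft Q-functions of $\pi$ under $\theta$ are $$V^\pi_\theta(s)=\mathbb E_{\tau\sim\pi}\Big[\sum_{t\ge0}\gamma^t\big(r(s_t,a_t;\theta)+\mathcal H(\pi(\cdot\mid s_t))\big)\,\Big|\,s_0=s\Big],\qquad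 Q^\pi_\theta(s,a)=r(s,a;\theta)+\gamma\,\mathbb E_{s'\sim P(\cdot\mid s,a)}\big[V^\pi_\theta(s')\big].$$ Put $V_\theta(s)=\max_\pi V_\theta^\pi(s)$ and $Q_\theta(s,a)=r(s,a;\theta)+\gamma\,\mathbb E_{s'\sim P(\cdot\mid s,a)}[V_\theta(s')]$, and let $\pi_\theta(a\mid s)\propto\exp Q_\theta(s,a)$. For a finite non-empty data set $\mathcal D$ of trajectories let $$\widehat L(\theta;\mathcal D)=\mathbb E_{\tau\sim\mathcal D}\Big[\sum_{t\ge0}\gamma^t r(s_t,a_t;\theta)\Big]-\mathbb E_{s_0\sim\rho}\big[V_\theta(s_0)\big],$$ where $\tau\sim\mathcal D$ means that $\tau$ is uniformly sampled from $\mathcal D$. **Algorithm.** Fix $\theta_0$, $\pi_0$, a number of iterations $K\ge1$, a step size $\alpha$ and an error level $\epsilon_{\rm app}\ge0$. For $k=0,\dots,K-1$: obtain from the history a (possibly random) function $\widehat Q_k$ with $\|\widehat Q_k-Q_k\|_\infty\le\epsilon_{\rm app}$, where $Q_k=Q^{\pi_k}_{\theta_k}$; set $\pi_{k+1}(a\mid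 s)\propto\exp\widehat Q_k(s,a)$; given the history including $\widehat Q_k$, sample $\tau^{\rm E}_k$ uniformly from $\mathcal D$ and a trajectory $\tau^{\rm A}_k$ of $\pi_{k+1}$ with $s_0\sim\rho$; set $\theta_{k+1}=\theta_k+\alpha\big(h(\theta_k,\tau^{\rm E}_k)-h(\theta_k,\tau^{\rm A}_k)\big)$, where $h(\theta,\tau)=\sum_{t\ge0}\gamma^t\nabla_\theta r(s_t,a_t;\theta)$. **Theorem.** For all $\theta$, the policy $\pi_\theta$ attains the maximum $V_\theta(s)$ for every $s$, and $\widehat L(\cdot;\mathcal D)$ is differentiable. Let $\alpha=\alpha_0/K^\sigma$ with fixed $\alpha_0>0$ and $\sigma\in(0,1)$. There is a constant $C$, depending only on $\mathcal S,\mathcal A,\gamma,C_r,L_r,L_g,\alpha_0,\sigma$, such that for all $K\ge1$, $\epsilon_{\rm app}\ge 0$ and every run of the algorithm the expectations below exist and $$\frac1K\sum_{k=0}^{K-1}\mathbb E\big[\|\log\pi_{k+1}-\log\pi_{\theta_k}\|_\infty\big]\le C\big(K^{-1}+K^{-\sigma}+\epsilon_{\rm app}\big),$$ $$\frac1K\sum_{k=0}^{K-1}\mathbb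 E\big[\|\nabla_\theta\widehat L(\theta_k;\mathcal D)\|^2\big]\le C\big(K^{-\sigma}+K^{-1+\sigma}+K^{-1}+\epsilon_{\rm app}\big),$$ where $\|\log\pi-\log\pi'\|_\infty=\max_{s,a}|\log\pi(a\mid s)-\log\pi'(a\mid s)|$. In particular, for $\sigma=1/2$ both left-hand sides are at most $C\big(K^{-1/2}+\epsilon_{\rm app}\big)$. -/

import Mathlib

open MeasureTheory ProbabilityTheory
open scoped BigOperators

namespace MLIRL

noncomputable section

/-- Stationary randomized policies: `π s` is the law of the action chosen in state `s`. -/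
abbrev Policy (S A : Type*) := S → PMF A

/-- Infinite state-action trajectories `(s_0, a_0), (s_1, a_1), …`. -/
abbrev Traj (S A : Type*) := ℕ → S × A

/-- The parameter space `ℝ^p` with the Euclidean norm. -/
abbrev Param (p : ℕ) := EuclideanSpace ℝ (Fin p)

section MDP

variable {S A : Type*}

/-- The law of `(s, a)` when `s ∼ ν` and `a ∼ π(· | s)`. -/
def pairLaw (ν : PMF S) (π : Policy S A) : PMF (S × A) :=
  ν.bind fun s => (π s).map (Prod.mk s)

variable [Fintype S] [MeasurableSpace S] [DiscreteMeasurableSpace S]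
variable [Fintype A] [MeasurableSpace A] [DiscreteMeasurableSpace A]

/-- One step of the controlled chain: given the trajectory up to time `n`, ending in `(s, a)`, the
next pair is drawn by `s' ∼ P(· | s, a)` and `a' ∼ π(· | s')`. -/
def stepKernel (P : S → A → PMF S) (π : Policy S A) (n : ℕ) :
    Kernel (∀ _ : Finset.Iic n, S × A) (S × A) :=
  (Kernel.ofFunOfCountable fun z : S × A => (pairLaw (P z.1 z.2) π).toMeasure).comap
    (fun x => x ⟨n, Finset.mem_Iic.2 le_rfl⟩) (measurable_pi_apply _)

instance (P : S → A → PMF S) (π : Policy S A) (n : ℕ) : IsMarkovKernel (stepKernel P π n) :=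
  ⟨fun x => by
    change IsProbabilityMeasure (pairLaw _ π).toMeasure
    infer_instance⟩

/-- The law on trajectories of the decision process with initial state law `ν`, transition
kernel `P` and policy `π`. -/
def trajLaw (P : S → A → PMF S) (ν : PMF S) (π : Policy S A) : Measure (Traj S A) :=
  Kernel.trajMeasure (X := fun _ => S × A) (pairLaw ν π).toMeasure (stepKernel P π)

/-- The Shannon entropy `- ∑ a, q(a) log q(a)`. -/
def entropy (q : PMF A) : ℝ := ∑ a, Real.negMulLog (q a).toReal

/-- The soft value function of the policy `π` for the reward function `u`:
`V(s) = E [ ∑ t, γ^t (u(s_t, a_t) + H(π(· | s_t))) | s_0 = s ]`. -/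
def softV (P : S → A → PMF S) (γ : ℝ) (u : S → A → ℝ) (π : Policy S A) (s : S) : ℝ :=
  ∫ τ, ∑' t : ℕ, γ ^ t * (u (τ t).1 (τ t).2 + entropy (π (τ t).1)) ∂(trajLaw P (PMF.pure s) π)

/-- The soft Q-function of the policy `π` for the reward function `u`. -/
def softQ (P : S → A → PMF S) (γ : ℝ) (u : S → A → ℝ) (π : Policy S A) (s : S) (a : A) : ℝ :=
  u s a + γ * ∑ s', (P s a s').toReal * softV P γ u π s'

/-- The optimal soft value function `V(s) = max_π V^π(s)`. -/
def optV (P : S → A → PMF S) (γ : ℝ) (u : S → A → ℝ) (s : S) : ℝ :=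
  ⨆ π : Policy S A, softV P γ u π s

/-- The optimal soft Q-function. -/
def optQ (P : S → A → PMF S) (γ : ℝ) (u : S → A → ℝ) (s : S) (a : A) : ℝ :=
  u s a + γ * ∑ s', (P s a s').toReal * optV P γ u s'

end MDP

section Softmax

variable {S A : Type*} [Fintype A] [Nonempty A]

/-- The policy `π(a | s) ∝ exp Q(s, a)`. -/
def softmaxPolicy (Q : S → A → ℝ) : Policy S A := fun s =>
  PMF.ofFintype (fun a => ENNReal.ofReal (Real.exp (Q s a) / ∑ b, Real.exp (Q s b))) (by
    have h : 0 < ∑ b, Real.exp (Q s b) :=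
      Finset.sum_pos (fun _ _ => Real.exp_pos _) Finset.univ_nonempty
    rw [← ENNReal.ofReal_sum_of_nonneg fun a _ => div_nonneg (Real.exp_pos _).le h.le,
      ← Finset.sum_div, div_self h.ne', ENNReal.ofReal_one])

end Softmax

section Learning

variable {S A : Type*} [Fintype S] [MeasurableSpace S] [DiscreteMeasurableSpace S]
variable [Fintype A] [Nonempty A] [MeasurableSpace A] [DiscreteMeasurableSpace A]
variable {p N : ℕ}

/-- The optimal policy `π(a | s) ∝ exp Q(s, a)`, with `Q` the optimal soft Q-function. -/
def optPolicy (P : S → A → PMF S) (γ : ℝ) (u : S → A → ℝ) : Policy S A :=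
  softmaxPolicy (optQ P γ u)

/-- The table of log-probabilities `log π(a | s)`; the norm of `S × A → ℝ` is the maximum norm. -/
def logPolicy (π : Policy S A) : S × A → ℝ := fun z => Real.log (π z.1 z.2).toReal

/-- The surrogate log-likelihood of a data set `D` of `N` trajectories:
`E_{τ ∼ D} [ ∑ t, γ^t r(s_t, a_t; θ) ] - E_{s_0 ∼ ρ} [ V_θ(s_0) ]`. -/
def surrogate (P : S → A → PMF S) (ρ : PMF S) (γ : ℝ) (r : Param p → S → A → ℝ)
    (D : Fin N → Traj S A) (θ : Param p) : ℝ :=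
  (1 / (N : ℝ)) * ∑ i, ∑' t : ℕ, γ ^ t * r θ (D i t).1 (D i t).2
    - ∑ s, (ρ s).toReal * optV P γ (r θ) s

/-- `h(θ, τ) = ∑ t, γ^t ∇_θ r(s_t, a_t; θ)`. -/
def discountedGrad (γ : ℝ) (r : Param p → S → A → ℝ) (θ : Param p) (τ : Traj S A) : Param p :=
  ∑' t : ℕ, γ ^ t • gradient (fun θ' => r θ' (τ t).1 (τ t).2) θ

/-- `(θ_k, π_k, Q̂_k, I_k, τ_k)` is a run of `K` iterations of the algorithm on the probability
space `(Ω, μ)`, with initialization `θ₀, π₀`, step size `α` and evaluation error at most `ε`.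
`ℱ k` is the history at the moment of iteration `k` when `Q̂_k` has been computed and the
trajectories have not been sampled; `D (I_k)` is the sampled expert trajectory and `τ_k` the
sampled agent trajectory. -/
structure IsRun (P : S → A → PMF S) (ρ : PMF S) (γ : ℝ) (r : Param p → S → A → ℝ)
    (D : Fin N → Traj S A) (θ₀ : Param p) (π₀ : Policy S A) (α ε : ℝ) (K : ℕ)
    {Ω : Type*} [mΩ : MeasurableSpace Ω] (μ : Measure Ω) (ℱ : Filtration ℕ mΩ)
    (θ : ℕ → Ω → Param p) (π : ℕ → Ω → Policy S A) (Qhat : ℕ → Ω → S → A → ℝ)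
    (I : ℕ → Ω → Fin N) (τ : ℕ → Ω → Traj S A) : Prop where
  /-- Initialization. -/
  init_param : ∀ ω, θ 0 ω = θ₀
  init_policy : ∀ ω, π 0 ω = π₀
  /-- Policy evaluation: `Q̂_k` depends on the history only (and possibly on extra randomness that
  is part of the history), and `‖Q̂_k - Q_k‖_∞ ≤ ε`, with `Q_k` the soft Q-function of `π_k`
  under the reward parameter `θ_k`. -/
  eval_measurable : ∀ k < K, ∀ s a, Measurable[ℱ k] fun ω => Qhat k ω s a
  eval_error : ∀ k < K, ∀ᵐ ω ∂μ, ∀ s a,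
    |Qhat k ω s a - softQ P γ (r (θ k ω)) (π k ω) s a| ≤ ε
  /-- Policy improvement: `π_{k+1}(a | s) ∝ exp Q̂_k(s, a)`. -/
  improvement : ∀ k < K, ∀ ω, π (k + 1) ω = softmaxPolicy (Qhat k ω)
  /-- Data sampling I: given the history, the expert trajectory is uniform on the data set. -/
  expert_measurable : ∀ k < K, Measurable[ℱ (k + 1)] (I k)
  expert_law : ∀ k < K, ∀ i : Fin N,
    μ[(I k ⁻¹' {i}).indicator (fun _ => (1 : ℝ)) | ℱ k] =ᵐ[μ] fun _ => 1 / (N : ℝ)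
  /-- Data sampling II: given the history, the agent trajectory is drawn from `π_{k+1}`. -/
  agent_measurable : ∀ k < K, Measurable[ℱ (k + 1)] (τ k)
  agent_law : ∀ k < K, ∀ B : Set (Traj S A), MeasurableSet B →
    μ[(τ k ⁻¹' B).indicator (fun _ => (1 : ℝ)) | ℱ k] =ᵐ[μ]
      fun ω => (trajLaw P ρ (π (k + 1) ω)).real B
  /-- Reward update: `θ_{k+1} = θ_k + α g_k` with `g_k = h(θ_k, τ_k^E) - h(θ_k, τ_k^A)`. -/
  update : ∀ k < K, ∀ ω, θ (k + 1) ω = θ k ω +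
    α • (discountedGrad γ r (θ k ω) (D (I k ω)) - discountedGrad γ r (θ k ω) (τ k ω))

end Learning

end

end MLIRL

namespace MLIRL

noncomputable section

/-! The policies and the reward parameter move together, but the policy error obeys an almost sure
recursion that can be solved before any expectation is taken. Let `e k` be the sup distance between
the soft Q-function of `π_k` and the optimal one, both at `θ_k`. An approximate soft policy
improvement contracts it by `γ` up to `2ε/(1-γ)` (`abs_softQ_softmaxPolicy_sub_optQ_le`). Moving `θ`
by at most `2αL_r/(1-γ)` shifts both Q-functions by a multiple of `α`. Hence `e k` is a geometric
transient plus `O(α + ε)` (`IsRun.ae_softQ_error`). As `Q ↦ log softmax Q` is 2-Lipschitz, averaging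
over `k` gives the first bound: the transient sums to `O(1)`, so it contributes `1/K`.

For the second bound the surrogate is treated as a bounded objective with a uniform quadratic
remainder. For the optimal value this remainder is an envelope argument (`abs_optV_remainder_le`):
each optimal policy competes at the other parameter, which squeezes the increment of the value
between two sums differing only to second order. No fixed-point equation is differentiated. Given
the history, the mean update direction is the true gradient with `π_{k+1}` in place of the optimal
policy, so its bias is a multiple of the policy error (`IsRun.integral_inner_direction_ge`).
Telescoping the resulting ascent inequality and dividing by `Kα` leaves `1/(Kα)`, the mean policy
error and `α`.

Trajectory measures are eliminated early: `integral_discounted` turns integrals of discounted sums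
into `val`, the unique solution of a linear Bellman equation on a finite set. Thereafter both
identities and estimates come from one maximum principle, `le_div_of_contraction`. -/

lemma toReal_pmf_le_one {X : Type*} (q : PMF X) (x : X) : (q x).toReal ≤ 1 := by
  simpa using ENNReal.toReal_mono ENNReal.one_ne_top (q.coe_le_one x)

lemma entropy_nonneg {A : Type*} [Fintype A] (q : PMF A) : 0 ≤ entropy q :=
  Finset.sum_nonneg fun a _ =>
    Real.negMulLog_nonneg ENNReal.toReal_nonneg (toReal_pmf_le_one q a)

/-! ### Finite averages. -/

section Average

variable {X E : Type*} [Fintype X] [NormedAddCommGroup E] [NormedSpace ℝ E]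

/-- The mean of `f` under the law `q` on a finite type. -/
def avg (q : PMF X) (f : X → E) : E := ∑ x, (q x).toReal • f x

lemma sum_toReal_pmf (q : PMF X) : ∑ x, (q x).toReal = 1 := by
  rw [← ENNReal.toReal_sum fun x _ => q.apply_ne_top x, ← tsum_fintype (L := .unconditional _),
    q.tsum_coe, ENNReal.toReal_one]

lemma avg_const (q : PMF X) (c : E) : avg q (fun _ => c) = c := by
  rw [avg, ← Finset.sum_smul, sum_toReal_pmf, one_smul]

lemma avg_add (q : PMF X) (f g : X → E) : avg q (fun x => f x + g x) = avg q f + avg q g := by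
  simp [avg, Finset.sum_add_distrib]

lemma avg_sub (q : PMF X) (f g : X → E) : avg q (fun x => f x - g x) = avg q f - avg q g := by
  simp [avg, smul_sub, Finset.sum_sub_distrib]

lemma avg_smul (q : PMF X) (c : ℝ) (f : X → E) : avg q (fun x => c • f x) = c • avg q f := by
  simp [avg, Finset.smul_sum, smul_comm c]

lemma avg_inner {F : Type*} [NormedAddCommGroup F] [InnerProductSpace ℝ F] (q : PMF X) (v : F)
    (f : X → F) : avg q (fun x => inner ℝ v (f x)) = inner ℝ v (avg q f) := by
  simp [avg, inner_sum, inner_smul_right]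

lemma avg_mono (q : PMF X) {f g : X → ℝ} (h : ∀ x, f x ≤ g x) : avg q f ≤ avg q g :=
  Finset.sum_le_sum fun x _ => mul_le_mul_of_nonneg_left (h x) ENNReal.toReal_nonneg

lemma avg_le (q : PMF X) {f : X → ℝ} {c : ℝ} (h : ∀ x, f x ≤ c) : avg q f ≤ c :=
  (avg_mono q h).trans_eq (avg_const q c)

lemma le_avg (q : PMF X) {f : X → ℝ} {c : ℝ} (h : ∀ x, c ≤ f x) : c ≤ avg q f :=
  (avg_const q c).symm.trans_le (avg_mono q h)

lemma norm_avg_le (q : PMF X) {f : X → E} {c : ℝ} (h : ∀ x, ‖f x‖ ≤ c) : ‖avg q f‖ ≤ c := by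
  refine (norm_sum_le _ _).trans ?_
  refine le_trans (Finset.sum_le_sum fun x _ => ?_) (avg_le q h)
  rw [norm_smul, Real.norm_of_nonneg ENNReal.toReal_nonneg, smul_eq_mul]

lemma abs_avg_sub_le (q : PMF X) {f g : X → ℝ} {c : ℝ} (h : ∀ x, |f x - g x| ≤ c) :
    |avg q f - avg q g| ≤ c := by
  rw [← avg_sub]
  exact norm_avg_le (E := ℝ) q h

lemma norm_avg_sub_avg_le (q q' : PMF X) {f : X → E} {c δ : ℝ} (hf : ∀ x, ‖f x‖ ≤ c)
    (hq : ∀ x, |(q x).toReal - (q' x).toReal| ≤ δ) :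
    ‖avg q f - avg q' f‖ ≤ Fintype.card X * (δ * c) := by
  rw [avg, avg, ← Finset.sum_sub_distrib]
  refine (norm_sum_le _ _).trans ?_
  rw [← nsmul_eq_mul, ← Finset.card_univ]
  refine Finset.sum_le_card_nsmul _ _ _ fun x _ => ?_
  rw [← sub_smul, norm_smul]
  exact mul_le_mul (hq x) (hf x) (norm_nonneg _) ((abs_nonneg _).trans (hq x))

lemma avg_pure [DecidableEq X] (x : X) (f : X → E) : avg (PMF.pure x) f = f x := by
  rw [avg, Finset.sum_eq_single x]
  · simp
  · intro y _ hy
    simp [PMF.pure_apply, hy]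
  · simp

end Average

/-- A function on a finite type whose every upper bound `M` improves to `c + γ M` is bounded by
`c / (1 - γ)`. -/
lemma le_div_of_contraction {X : Type*} [Finite X] {γ c : ℝ} (hγ : γ < 1) {x : X → ℝ}
    (h : ∀ M, (∀ z, x z ≤ M) → ∀ z, x z ≤ c + γ * M) (z : X) : x z ≤ c / (1 - γ) := by
  have : Nonempty X := ⟨z⟩
  obtain ⟨w, hw⟩ := Finite.exists_max x
  refine (hw z).trans ?_
  rw [le_div_iff₀ (by linarith)]
  linarith [h (x w) hw w]

/-! ### Log-sum-exp, the Gibbs inequality and softmax policies. -/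

section Softmax

variable {S A : Type*} [Fintype A] [Nonempty A]

/-- The function `log ∑ exp`. -/
def lse (x : A → ℝ) : ℝ := Real.log (∑ a, Real.exp (x a))

lemma sum_exp_pos (x : A → ℝ) : 0 < ∑ a, Real.exp (x a) :=
  Finset.sum_pos (fun _ _ => Real.exp_pos _) Finset.univ_nonempty

/-- `lse` is monotone and commutes with adding constants. The one-sided form is kept because the
comparison with the optimal value only controls differences from above. -/
lemma lse_le_lse_add {x y : A → ℝ} {c : ℝ} (h : ∀ a, x a ≤ y a + c) : lse x ≤ lse y + c := by
  rw [lse, Real.log_le_iff_le_exp (sum_exp_pos x), Real.exp_add, lse, Real.exp_log (sum_exp_pos y),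
    Finset.sum_mul]
  refine Finset.sum_le_sum fun a _ => ?_
  rw [← Real.exp_add]
  exact Real.exp_le_exp.2 (h a)

lemma abs_lse_sub_le {x y : A → ℝ} {c : ℝ} (h : ∀ a, |x a - y a| ≤ c) :
    |lse x - lse y| ≤ c := by
  have h1 : lse x ≤ lse y + c := lse_le_lse_add fun a => by linarith [(abs_le.1 (h a)).2]
  have h2 : lse y ≤ lse x + c := lse_le_lse_add fun a => by linarith [(abs_le.1 (h a)).1]
  rw [abs_le]
  constructor <;> linarith

lemma toReal_softmaxPolicy (Q : S → A → ℝ) (s : S) (a : A) :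
    (softmaxPolicy Q s a).toReal = Real.exp (Q s a - lse (Q s)) := by
  rw [softmaxPolicy, PMF.ofFintype_apply, ENNReal.toReal_ofReal
    (div_nonneg (Real.exp_pos _).le (sum_exp_pos _).le), Real.exp_sub, lse,
    Real.exp_log (sum_exp_pos _)]

lemma logPolicy_softmaxPolicy (Q : S → A → ℝ) (z : S × A) :
    logPolicy (softmaxPolicy Q) z = Q z.1 z.2 - lse (Q z.1) := by
  rw [logPolicy, toReal_softmaxPolicy, Real.log_exp]

/-- The Gibbs variational inequality. -/
lemma avg_add_entropy_le_lse (q : PMF A) (x : A → ℝ) : avg q x + entropy q ≤ lse x := by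
  -- The inequality `log t ≤ t - 1` at the ratio of Gibbs weight to `q a`, multiplied by `q a`.
  -- Summed over `a`, the right-hand side is `1 - 1`. Zero mass is treated apart because the ratio
  -- is then meaningless.
  have hterm : ∀ a, (q a).toReal * (x a - lse x) + Real.negMulLog (q a).toReal
      ≤ Real.exp (x a - lse x) - (q a).toReal := by
    intro a
    rcases (ENNReal.toReal_nonneg : 0 ≤ (q a).toReal).eq_or_lt with h | h
    · rw [← h]
      simp [Real.exp_nonneg]
    · have h1 := Real.log_le_sub_one_of_pos (div_pos (Real.exp_pos (x a - lse x)) h)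
      rw [Real.log_div (Real.exp_pos _).ne' h.ne', Real.log_exp] at h1
      have h2 := mul_le_mul_of_nonneg_left h1 h.le
      rw [mul_sub, mul_sub _ _ (1 : ℝ), mul_div_cancel₀ _ h.ne', mul_one] at h2
      rw [Real.negMulLog]
      linarith
  have hsum := Finset.sum_le_sum fun a (_ : a ∈ Finset.univ) => hterm a
  have h1 : ∑ a, Real.exp (x a - lse x) = 1 := by
    simp_rw [Real.exp_sub, ← Finset.sum_div, lse, Real.exp_log (sum_exp_pos x)]
    exact div_self (sum_exp_pos x).ne'
  rw [Finset.sum_add_distrib, Finset.sum_sub_distrib, h1, sum_toReal_pmf] at hsum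
  simp_rw [mul_sub] at hsum
  rw [Finset.sum_sub_distrib, ← Finset.sum_mul, sum_toReal_pmf] at hsum
  simp only [avg, entropy, smul_eq_mul]
  linarith

lemma avg_softmaxPolicy_add_entropy (Q : S → A → ℝ) (s : S) :
    avg (softmaxPolicy Q s) (Q s) + entropy (softmaxPolicy Q s) = lse (Q s) := by
  rw [avg, entropy, ← Finset.sum_add_distrib]
  have : ∀ a, (softmaxPolicy Q s a).toReal • Q s a
      + Real.negMulLog (softmaxPolicy Q s a).toReal
      = (softmaxPolicy Q s a).toReal * lse (Q s) := fun a => by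
    have h := logPolicy_softmaxPolicy Q (s, a)
    simp only [logPolicy] at h
    rw [Real.negMulLog, h, smul_eq_mul]
    ring
  rw [Finset.sum_congr rfl fun a _ => this a, ← Finset.sum_mul, sum_toReal_pmf, one_mul]

lemma entropy_le (q : PMF A) : entropy q ≤ Real.log (Fintype.card A) := by
  have h := avg_add_entropy_le_lse q (fun _ => (0 : ℝ))
  rw [avg_const] at h
  simpa [lse] using h

/-- One `c` comes from the Q-functions themselves and one from their normalisers. -/
lemma abs_logPolicy_softmaxPolicy_sub_le {Q Q' : S → A → ℝ} {c : ℝ}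
    (h : ∀ s a, |Q s a - Q' s a| ≤ c) (z : S × A) :
    |logPolicy (softmaxPolicy Q) z - logPolicy (softmaxPolicy Q') z| ≤ 2 * c := by
  rw [logPolicy_softmaxPolicy, logPolicy_softmaxPolicy]
  have h1 := abs_le.1 (h z.1 z.2)
  have h2 := abs_le.1 (abs_lse_sub_le (h z.1))
  rw [abs_le]
  constructor <;> linarith

/-- The exponential is 1-Lipschitz on the nonpositive half-line, where log-probabilities live. -/
lemma abs_softmaxPolicy_sub_le {Q Q' : S → A → ℝ} {c : ℝ}
    (h : ∀ s a, |logPolicy (softmaxPolicy Q) (s, a) - logPolicy (softmaxPolicy Q') (s, a)| ≤ c)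
    (s : S) (a : A) :
    |(softmaxPolicy Q s a).toReal - (softmaxPolicy Q' s a).toReal| ≤ c := by
  have key : ∀ x y : ℝ, x ≤ 0 → |x - y| ≤ c → Real.exp x - Real.exp y ≤ c := by
    intro x y hx hxy
    have h1 : Real.exp x * (1 + (y - x)) ≤ Real.exp x * Real.exp (y - x) :=
      mul_le_mul_of_nonneg_left (by linarith [Real.add_one_le_exp (y - x)]) (Real.exp_pos _).le
    rw [← Real.exp_add, add_sub_cancel] at h1
    have h2 : Real.exp x * (x - y) ≤ 1 * |x - y| :=
      (mul_le_mul_of_nonneg_left (le_abs_self _) (Real.exp_pos _).le).trans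
        (mul_le_mul_of_nonneg_right (Real.exp_le_one_iff.2 hx) (abs_nonneg _))
    linarith
  have hle : ∀ Q : S → A → ℝ, Q s a - lse (Q s) ≤ 0 := fun Q => by
    rw [← Real.exp_le_one_iff, ← toReal_softmaxPolicy]
    exact toReal_pmf_le_one _ _
  have h0 := h s a
  rw [logPolicy_softmaxPolicy, logPolicy_softmaxPolicy] at h0
  dsimp only at h0
  rw [toReal_softmaxPolicy, toReal_softmaxPolicy, abs_le]
  have h1 := key _ _ (hle Q) h0
  rw [abs_sub_comm] at h0
  have h2 := key _ _ (hle Q') h0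
  constructor <;> linarith

end Softmax

/-! ### Marginals of the trajectory law. -/

section Trajectories

variable {S A : Type*} [Fintype S] [MeasurableSpace S] [DiscreteMeasurableSpace S]
variable [Fintype A] [MeasurableSpace A] [DiscreteMeasurableSpace A]
variable {E : Type*} [NormedAddCommGroup E] [NormedSpace ℝ E]

/-- The conditional mean of `f(s', a')` after one step of the chain from `(s, a)`. -/
def stepOp (P : S → A → PMF S) (π : Policy S A) (f : S → A → E) : S → A → E := fun s a =>
  avg (P s a) fun s' => avg (π s') (f s')

lemma pairLaw_apply {S A : Type*} (ν : PMF S) (π : Policy S A) (s : S) (a : A) :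
    pairLaw ν π (s, a) = ν s * π s a := by
  classical
  rw [pairLaw, PMF.bind_apply, tsum_eq_single s]
  · rw [PMF.map_apply, tsum_eq_single a]
    · simp
    · intro b hb
      simp [Ne.symm hb]
  · intro s' hs'
    rw [PMF.map_apply]
    simp [Ne.symm hs']

variable [CompleteSpace E]

lemma integral_pairLaw (ν : PMF S) (π : Policy S A) (f : S → A → E) :
    ∫ z, f z.1 z.2 ∂(pairLaw ν π).toMeasure = avg ν fun s => avg (π s) (f s) := by
  rw [PMF.integral_eq_sum, Fintype.sum_prod_type]
  simp [pairLaw_apply, avg, Finset.smul_sum, mul_smul]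

instance (P : S → A → PMF S) (ν : PMF S) (π : Policy S A) :
    IsProbabilityMeasure (trajLaw P ν π) := by
  unfold trajLaw
  infer_instance

omit [CompleteSpace E] [NormedSpace ℝ E] in
lemma stronglyMeasurable_eval (f : S → A → E) (t : ℕ) :
    StronglyMeasurable fun τ : Traj S A => f (τ t).1 (τ t).2 :=
  (StronglyMeasurable.of_discrete (f := fun z : S × A => f z.1 z.2)).comp_measurable
    (measurable_pi_apply t)

omit [MeasurableSpace S] [DiscreteMeasurableSpace S] [MeasurableSpace A]
  [DiscreteMeasurableSpace A] [CompleteSpace E] [NormedSpace ℝ E] in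
lemma exists_norm_le (f : S → A → E) : ∃ c, ∀ s a, ‖f s a‖ ≤ c :=
  ⟨∑ s, ∑ a, ‖f s a‖, fun s a =>
    (Finset.single_le_sum (f := fun a => ‖f s a‖) (fun _ _ => norm_nonneg _)
      (Finset.mem_univ a)).trans (Finset.single_le_sum (f := fun s => ∑ a, ‖f s a‖)
        (fun _ _ => Finset.sum_nonneg fun _ _ => norm_nonneg _) (Finset.mem_univ s))⟩

omit [CompleteSpace E] [NormedSpace ℝ E] in
lemma integrable_eval (P : S → A → PMF S) (ν : PMF S) (π : Policy S A) (f : S → A → E) (t : ℕ) :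
    Integrable (fun τ : Traj S A => f (τ t).1 (τ t).2) (trajLaw P ν π) := by
  obtain ⟨c, hc⟩ := exists_norm_le f
  exact Integrable.of_bound (stronglyMeasurable_eval f t).aestronglyMeasurable c
    (Filter.Eventually.of_forall fun τ => hc _ _)

lemma integral_eval_zero (P : S → A → PMF S) (ν : PMF S) (π : Policy S A) (f : S → A → E) :
    ∫ τ, f (τ 0).1 (τ 0).2 ∂(trajLaw P ν π) = avg ν fun s => avg (π s) (f s) := by
  have hmap : (trajLaw P ν π).map (fun τ => τ 0) = (pairLaw ν π).toMeasure := by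
    have h1 : (fun τ : Traj S A => τ 0)
        = (fun x : (∀ _ : Finset.Iic 0, S × A) => x ⟨0, Finset.mem_Iic.2 le_rfl⟩) ∘
          Preorder.frestrictLe (π := fun _ => S × A) 0 := rfl
    rw [h1, ← Measure.map_map (measurable_pi_apply _) (by fun_prop), trajLaw,
      Kernel.trajMeasure, Measure.map_comp _ _ (by fun_prop), Kernel.traj_map_frestrictLe,
      Kernel.partialTraj_self, Measure.id_comp,
      Measure.map_map (measurable_pi_apply _) (by fun_prop)]
    exact Measure.map_id
  rw [← integral_pairLaw, ← hmap, integral_map (measurable_pi_apply 0).aemeasurable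
    (StronglyMeasurable.of_discrete (f := fun z : S × A => f z.1 z.2)).aestronglyMeasurable]

/-- The Markov property: the joint law of the past and the next pair is a composition-product with
the step kernel, which sees only the last pair. Integrating out the next pair leaves `stepOp`. -/
lemma integral_eval_succ (P : S → A → PMF S) (ν : PMF S) (π : Policy S A) (f : S → A → E)
    (t : ℕ) :
    ∫ τ, f (τ (t + 1)).1 (τ (t + 1)).2 ∂(trajLaw P ν π)
      = ∫ τ, stepOp P π f (τ t).1 (τ t).2 ∂(trajLaw P ν π) := by
  have hf : StronglyMeasurable fun y : (∀ _ : Finset.Iic t, S × A) × (S × A) => f y.2.1 y.2.2 :=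
    (StronglyMeasurable.of_discrete (f := fun z : S × A => f z.1 z.2)).comp_measurable
      measurable_snd
  have hm : Measurable fun x : Traj S A =>
      (Preorder.frestrictLe (π := fun _ => S × A) t x, x (t + 1)) := by
    fun_prop
  have key := Kernel.map_frestrictLe_trajMeasure_compProd_eq_map_trajMeasure
    (X := fun _ => S × A) (μ₀ := (pairLaw ν π).toMeasure) (κ := stepKernel P π) (a := t)
  have h1 : ∫ τ, f (τ (t + 1)).1 (τ (t + 1)).2 ∂(trajLaw P ν π)
      = ∫ y, f y.2.1 y.2.2 ∂((trajLaw P ν π).map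
        (fun x : Traj S A => (Preorder.frestrictLe (π := fun _ => S × A) t x, x (t + 1)))) := by
    rw [integral_map hm.aemeasurable hf.aestronglyMeasurable]
  rw [h1]
  unfold trajLaw at *
  rw [← key, Measure.integral_compProd, integral_map (by fun_prop)]
  · refine integral_congr_ae (Filter.Eventually.of_forall fun τ => ?_)
    exact integral_pairLaw (P (τ t).1 (τ t).2) π f
  · exact hf.integral_kernel_prod_right'.aestronglyMeasurable
  · obtain ⟨c, hc⟩ := exists_norm_le f
    exact Integrable.of_bound hf.aestronglyMeasurable c
      (Filter.Eventually.of_forall fun y => hc _ _)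

lemma integral_eval (P : S → A → PMF S) (ν : PMF S) (π : Policy S A) (f : S → A → E) (t : ℕ) :
    ∫ τ, f (τ t).1 (τ t).2 ∂(trajLaw P ν π)
      = avg ν fun s => avg (π s) ((stepOp P π)^[t] f s) := by
  induction t generalizing f with
  | zero => exact integral_eval_zero P ν π f
  | succ t ih => rw [integral_eval_succ, ih, Function.iterate_succ_apply]

end Trajectories

lemma hasSum_avg {X E ι : Type*} [Fintype X] [NormedAddCommGroup E] [NormedSpace ℝ E]
    (q : PMF X) {F : ι → X → E} {G : X → E} (h : ∀ x, HasSum (fun t => F t x) (G x)) :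
    HasSum (fun t => avg q (F t)) (avg q G) :=
  hasSum_sum fun x _ => (h x).const_smul _

lemma summable_discount {E : Type*} [NormedAddCommGroup E] [NormedSpace ℝ E] [CompleteSpace E]
    {γ c : ℝ} (hγ0 : 0 ≤ γ) (hγ1 : γ < 1) {x : ℕ → E} (hx : ∀ t, ‖x t‖ ≤ c) :
    Summable fun t => γ ^ t • x t := by
  refine Summable.of_norm_bounded ((summable_geometric_of_lt_one hγ0 hγ1).mul_right c) fun t => ?_
  rw [norm_smul, norm_pow, Real.norm_of_nonneg hγ0]
  exact mul_le_mul_of_nonneg_left (hx t) (pow_nonneg hγ0 t)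

lemma norm_tsum_discount_le {E : Type*} [NormedAddCommGroup E] [NormedSpace ℝ E]
    {γ c : ℝ} (hγ0 : 0 ≤ γ) (hγ1 : γ < 1) {x : ℕ → E} (hx : ∀ t, ‖x t‖ ≤ c) :
    ‖∑' t, γ ^ t • x t‖ ≤ c / (1 - γ) := by
  refine tsum_of_norm_bounded (g := fun t => γ ^ t * c) ?_ fun t => ?_
  · rw [div_eq_inv_mul]
    exact (hasSum_geometric_of_lt_one hγ0 hγ1).mul_right c
  · rw [norm_smul, norm_pow, Real.norm_of_nonneg hγ0]
    exact mul_le_mul_of_nonneg_left (hx t) (pow_nonneg hγ0 t)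

/-! ### Discounted sums and linear Bellman equations. -/

section Value

variable {S A : Type*} [Fintype S] [Fintype A]
variable {E : Type*} [NormedAddCommGroup E] [NormedSpace ℝ E]

/-- The discounted sum of `f` along the chain started from a state-action pair. -/
def pairVal (P : S → A → PMF S) (γ : ℝ) (π : Policy S A) (f : S → A → E) (s : S) (a : A) : E :=
  ∑' t : ℕ, γ ^ t • (stepOp P π)^[t] f s a

/-- The discounted sum of `f` along the chain started from a state. -/
def val (P : S → A → PMF S) (γ : ℝ) (π : Policy S A) (f : S → A → E) (s : S) : E :=
  avg (π s) (pairVal P γ π f s)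

lemma norm_iterate_stepOp_le (P : S → A → PMF S) (π : Policy S A) {f : S → A → E} {c : ℝ}
    (hf : ∀ s a, ‖f s a‖ ≤ c) (t : ℕ) (s : S) (a : A) : ‖(stepOp P π)^[t] f s a‖ ≤ c := by
  induction t generalizing s a with
  | zero => exact hf s a
  | succ t ih =>
    rw [Function.iterate_succ_apply']
    exact norm_avg_le _ fun s' => norm_avg_le _ fun a' => ih s' a'

variable [CompleteSpace E] {γ : ℝ} (hγ0 : 0 ≤ γ) (hγ1 : γ < 1) (P : S → A → PMF S)
variable (π : Policy S A) (f : S → A → E)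

include hγ0 hγ1

lemma hasSum_pairVal (s : S) (a : A) :
    HasSum (fun t => γ ^ t • (stepOp P π)^[t] f s a) (pairVal P γ π f s a) := by
  obtain ⟨c, hc⟩ := exists_norm_le f
  exact (summable_discount hγ0 hγ1 fun t => norm_iterate_stepOp_le P π hc t s a).hasSum

lemma hasSum_val (s : S) :
    HasSum (fun t => γ ^ t • avg (π s) ((stepOp P π)^[t] f s)) (val P γ π f s) := by
  simp_rw [← avg_smul]
  exact hasSum_avg (π s) fun a => hasSum_pairVal hγ0 hγ1 P π f s a

lemma pairVal_eq (s : S) (a : A) :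
    pairVal P γ π f s a = f s a + γ • avg (P s a) (val P γ π f) := by
  have h := (hasSum_avg (P s a) fun s' => hasSum_val hγ0 hγ1 P π f s').const_smul γ
  refine (hasSum_pairVal hγ0 hγ1 P π f s a).unique ?_
  rw [← hasSum_nat_add_iff' 1]
  simp only [Finset.range_one, Finset.sum_singleton, pow_zero, one_smul, Function.iterate_zero,
    id_eq, add_sub_cancel_left]
  convert h using 2 with t
  rw [Function.iterate_succ_apply', avg_smul, smul_smul, pow_succ']
  rfl

lemma val_eq (s : S) :
    val P γ π f s = avg (π s) fun a => f s a + γ • avg (P s a) (val P γ π f) := by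
  simp_rw [← pairVal_eq hγ0 hγ1]
  rfl

omit [CompleteSpace E] in
/-- A solution of a linear Bellman equation is bounded by the bound of its source term divided
by `1 - γ`. -/
lemma norm_le_of_bellman {c : ℝ} {X g : S → E}
    (hX : ∀ s, X s = g s + avg (π s) fun a => γ • avg (P s a) X) (hg : ∀ s, ‖g s‖ ≤ c) (s : S) :
    ‖X s‖ ≤ c / (1 - γ) := by
  refine le_div_of_contraction (x := fun s => ‖X s‖) hγ1 (fun M hM s => ?_) s
  rw [hX s]
  refine (norm_add_le _ _).trans (add_le_add (hg s) (norm_avg_le _ fun a => ?_))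
  rw [norm_smul, Real.norm_of_nonneg hγ0]
  exact mul_le_mul_of_nonneg_left (norm_avg_le _ hM) hγ0

lemma norm_val_le {c : ℝ} (hf : ∀ s a, ‖f s a‖ ≤ c) (s : S) :
    ‖val P γ π f s‖ ≤ c / (1 - γ) := by
  refine norm_le_of_bellman hγ0 hγ1 P π (g := fun s => avg (π s) (f s)) (fun s => ?_)
    (fun s => norm_avg_le _ (hf s)) s
  rw [← avg_add, ← val_eq hγ0 hγ1]

/-- The difference of two solutions solves the equation with zero source, hence vanishes. Identities
for `val` can therefore be proved by checking the Bellman equation, without handling series. -/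
lemma val_unique {X : S → E} (hX : ∀ s, X s = avg (π s) fun a => f s a + γ • avg (P s a) X)
    (s : S) : X s = val P γ π f s := by
  have h := norm_le_of_bellman hγ0 hγ1 P π (c := 0) (g := fun _ => (0 : E))
    (X := fun s => X s - val P γ π f s) (fun s => ?_) (fun s => by simp) s
  · rw [zero_div] at h
    exact sub_eq_zero.1 (norm_le_zero_iff.1 h)
  · rw [hX s, val_eq hγ0 hγ1, zero_add, ← avg_sub]
    refine congrArg (avg (π s)) (funext fun a => ?_)
    rw [avg_sub, smul_sub, add_sub_add_left_eq_sub]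

lemma val_sub (g : S → A → E) (s : S) :
    val P γ π (fun s a => f s a - g s a) s = val P γ π f s - val P γ π g s := by
  symm
  refine val_unique hγ0 hγ1 P π _ (X := fun s => val P γ π f s - val P γ π g s) (fun s => ?_) s
  rw [val_eq hγ0 hγ1 P π f, val_eq hγ0 hγ1 P π g, ← avg_sub]
  refine congrArg (avg (π s)) (funext fun a => ?_)
  rw [avg_sub, smul_sub, add_sub_add_comm]

lemma val_inner {F : Type*} [NormedAddCommGroup F] [InnerProductSpace ℝ F] [CompleteSpace F]
    (v : F) (g : S → A → F) (s : S) :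
    val P γ π (fun s a => inner ℝ v (g s a)) s = inner ℝ v (val P γ π g s) := by
  symm
  refine val_unique hγ0 hγ1 P π _ (X := fun s => inner ℝ v (val P γ π g s)) (fun s => ?_) s
  rw [val_eq hγ0 hγ1 P π g, ← avg_inner]
  simp_rw [inner_add_right, inner_smul_right, avg_inner, smul_eq_mul]

/-- Discounted sums are Lipschitz in the policy. -/
lemma norm_val_sub_val_le (π' : Policy S A) {c δ : ℝ} (hf : ∀ s a, ‖f s a‖ ≤ c)
    (hπ : ∀ s a, |(π s a).toReal - (π' s a).toReal| ≤ δ) (s : S) :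
    ‖val P γ π f s - val P γ π' f s‖
      ≤ Fintype.card A * (δ * (c / (1 - γ))) / (1 - γ) := by
  -- Performance difference: the gap solves the Bellman equation of `π`, its source being the
  -- discounted sums under `π'` averaged against `π - π'`. One factor `1/(1-γ)` bounds those sums,
  -- the other propagates the source.
  refine norm_le_of_bellman hγ0 hγ1 P π (X := fun s => val P γ π f s - val P γ π' f s)
    (g := fun s => avg (π s) (pairVal P γ π' f s) - avg (π' s) (pairVal P γ π' f s))
    (fun s => ?_) (fun s => norm_avg_sub_avg_le _ _ (fun a => ?_) (hπ s)) s
  · rw [val_eq hγ0 hγ1 P π f, val]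
    rw [show pairVal P γ π' f s = fun a => f s a + γ • avg (P s a) (val P γ π' f) from
      funext fun a => pairVal_eq hγ0 hγ1 P π' f s a]
    have : ∀ a, f s a + γ • avg (P s a) (val P γ π f)
        = (f s a + γ • avg (P s a) (val P γ π' f))
          + γ • avg (P s a) (fun s => val P γ π f s - val P γ π' f s) := fun a => by
      rw [avg_sub, smul_sub]
      abel
    rw [show (fun a => f s a + γ • avg (P s a) (val P γ π f)) = fun a => _ from funext this,
      avg_add]
    abel
  · exact norm_tsum_discount_le hγ0 hγ1 fun t => norm_iterate_stepOp_le P π' hf t s a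

variable [MeasurableSpace S] [DiscreteMeasurableSpace S]
variable [MeasurableSpace A] [DiscreteMeasurableSpace A]

/-- Absolute convergence allows integration term by term, and each term is an iterate of `stepOp`.
-/
lemma integral_discounted (ν : PMF S) :
    ∫ τ, ∑' t : ℕ, γ ^ t • f (τ t).1 (τ t).2 ∂(trajLaw P ν π) = avg ν (val P γ π f) := by
  obtain ⟨c, hc⟩ := exists_norm_le f
  have h := hasSum_integral_of_summable_integral_norm (μ := trajLaw P ν π)
    (F := fun (t : ℕ) (τ : Traj S A) => γ ^ t • f (τ t).1 (τ t).2)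
    (fun t => (integrable_eval P ν π f t).smul _) ?_
  · refine h.unique ?_
    simp_rw [integral_smul, integral_eval, ← avg_smul ν]
    exact hasSum_avg ν fun s => hasSum_val hγ0 hγ1 P π f s
  · have h1 : ∀ t, ∫ τ, ‖γ ^ t • f (τ t).1 (τ t).2‖ ∂(trajLaw P ν π)
        = γ ^ t • ∫ τ, ‖f (τ t).1 (τ t).2‖ ∂(trajLaw P ν π) := fun t => by
      rw [← integral_smul]
      simp_rw [norm_smul, norm_pow, Real.norm_of_nonneg hγ0, smul_eq_mul]
    simp_rw [h1]
    refine summable_discount hγ0 hγ1 (c := c) fun t => ?_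
    rw [integral_eval P ν π (fun s a => ‖f s a‖)]
    exact norm_avg_le _ fun s => norm_avg_le _ fun a =>
      norm_iterate_stepOp_le P π (fun s a => by simpa using hc s a) t s a

omit E [NormedAddCommGroup E] [NormedSpace ℝ E] [CompleteSpace E] f in
lemma softV_eq_val (u : S → A → ℝ) (s : S) :
    softV P γ u π s = val P γ π (fun s a => u s a + entropy (π s)) s := by
  classical
  rw [softV, ← avg_pure s (val P γ π _), ← integral_discounted hγ0 hγ1]
  rfl

end Value

/-! ### Soft optimality equation and approximate policy iteration. -/

section Optimality

variable {S A : Type*} [Fintype S] [MeasurableSpace S] [DiscreteMeasurableSpace S]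
variable [Fintype A] [MeasurableSpace A] [DiscreteMeasurableSpace A]
variable {γ : ℝ} (P : S → A → PMF S)

lemma softQ_eq_avg (u : S → A → ℝ) (π : Policy S A) (s : S) (a : A) :
    softQ P γ u π s a = u s a + γ * avg (P s a) (softV P γ u π) := rfl

lemma optQ_eq_avg (u : S → A → ℝ) (s : S) (a : A) :
    optQ P γ u s a = u s a + γ * avg (P s a) (optV P γ u) := rfl

/-- Since `c + γ c/(1-γ) = c/(1-γ)`, bounds on values pass to Q-functions with the same constant. -/
lemma abs_add_mul_avg_sub_le (hγ0 : 0 ≤ γ) (hγ1 : γ < 1) {X : Type*} [Fintype X] (q : PMF X)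
    {x x' c : ℝ} {V V' : X → ℝ} (hx : |x - x'| ≤ c) (hV : ∀ s, |V s - V' s| ≤ c / (1 - γ)) :
    |(x + γ * avg q V) - (x' + γ * avg q V')| ≤ c / (1 - γ) := by
  have h1 := mul_le_mul_of_nonneg_left (abs_avg_sub_le q hV) hγ0
  have h2 : c + γ * (c / (1 - γ)) = c / (1 - γ) := by
    have : (1 - γ) ≠ 0 := by linarith
    field_simp
    ring
  rw [add_sub_add_comm, ← mul_sub]
  refine (abs_add_le _ _).trans ?_
  rw [abs_mul, abs_of_nonneg hγ0, ← h2]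
  exact add_le_add hx h1

variable (hγ0 : 0 ≤ γ) (hγ1 : γ < 1)

include hγ0 hγ1

lemma softV_bellman (u : S → A → ℝ) (π : Policy S A) (s : S) :
    softV P γ u π s = avg (π s) (softQ P γ u π s) + entropy (π s) := by
  rw [softV_eq_val hγ0 hγ1, val_eq hγ0 hγ1, ← avg_const (π s) (entropy (π s)), ← avg_add]
  refine congrArg (avg (π s)) (funext fun a => ?_)
  rw [softQ_eq_avg, show softV P γ u π = val P γ π _ from
    funext fun s => softV_eq_val hγ0 hγ1 P π u s, smul_eq_mul, avg_const]
  ring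

/-- For a fixed policy the entropy cancels, so the soft value is affine in the reward. The envelope
argument rests on this. -/
lemma softV_sub_softV (u u' : S → A → ℝ) (π : Policy S A) (s : S) :
    softV P γ u π s - softV P γ u' π s = val P γ π (fun s a => u s a - u' s a) s := by
  rw [softV_eq_val hγ0 hγ1, softV_eq_val hγ0 hγ1, ← val_sub hγ0 hγ1]
  simp

lemma abs_softV_sub_le {u u' : S → A → ℝ} {c : ℝ} (h : ∀ s a, |u s a - u' s a| ≤ c)
    (π : Policy S A) (s : S) : |softV P γ u π s - softV P γ u' π s| ≤ c / (1 - γ) := by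
  rw [softV_sub_softV P hγ0 hγ1]
  exact norm_val_le (E := ℝ) hγ0 hγ1 P π _ h s

lemma abs_softQ_sub_le {u u' : S → A → ℝ} {c : ℝ} (h : ∀ s a, |u s a - u' s a| ≤ c)
    (π : Policy S A) (s : S) (a : A) :
    |softQ P γ u π s a - softQ P γ u' π s a| ≤ c / (1 - γ) :=
  abs_add_mul_avg_sub_le hγ0 hγ1 _ (h s a) (abs_softV_sub_le P hγ0 hγ1 h π)

variable [Nonempty A]

lemma abs_softV_le {u : S → A → ℝ} {c : ℝ} (h : ∀ s a, 0 ≤ u s a ∧ u s a ≤ c)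
    (π : Policy S A) (s : S) :
    |softV P γ u π s| ≤ (c + Real.log (Fintype.card A)) / (1 - γ) := by
  rw [softV_eq_val hγ0 hγ1]
  refine norm_val_le (E := ℝ) hγ0 hγ1 P π _ (fun s a => ?_) s
  have h1 := entropy_nonneg (π s)
  have h2 := entropy_le (π s)
  have h3 := h s a
  rw [Real.norm_of_nonneg (by linarith)]
  linarith

omit [MeasurableSpace S] [DiscreteMeasurableSpace S] [MeasurableSpace A]
  [DiscreteMeasurableSpace A] in
/-- The optimality equation `V(s) = log ∑ exp (u(s, a) + γ E V(s'))` has a solution. -/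
lemma exists_optimality_fixedPoint (u : S → A → ℝ) :
    ∃ V : S → ℝ, ∀ s, V s = lse fun a => u s a + γ * avg (P s a) V := by
  let B : (S → ℝ) → S → ℝ := fun V s => lse fun a => u s a + γ * avg (P s a) V
  have hB : ContractingWith ⟨γ, hγ0⟩ B := by
    refine ⟨by exact_mod_cast hγ1, LipschitzWith.of_dist_le_mul fun V W => ?_⟩
    refine (dist_pi_le_iff (mul_nonneg hγ0 dist_nonneg)).2 fun s => ?_
    rw [Real.dist_eq]
    refine abs_lse_sub_le fun a => ?_
    rw [add_sub_add_left_eq_sub, ← mul_sub, abs_mul, abs_of_nonneg hγ0]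
    refine mul_le_mul_of_nonneg_left (abs_avg_sub_le _ fun s' => ?_) hγ0
    rw [← Real.dist_eq]
    exact dist_le_pi_dist V W s'
  exact ⟨hB.fixedPoint, fun s => (congrFun hB.fixedPoint_isFixedPt s).symm⟩

/-- By the Gibbs inequality the policy value is at most `lse` of its own Q-function. So an upper
bound `M` on its excess over `V` improves to `γ M`, which forces the excess to be nonpositive. -/
lemma softV_le_of_optimality {u : S → A → ℝ} {V : S → ℝ}
    (hV : ∀ s, V s = lse fun a => u s a + γ * avg (P s a) V) (π : Policy S A) (s : S) :
    softV P γ u π s ≤ V s := by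
  have h := le_div_of_contraction (c := 0) (x := fun s => softV P γ u π s - V s) hγ1
    (fun M hM s => ?_) s
  · rw [zero_div] at h
    linarith
  · have h1 := avg_add_entropy_le_lse (π s) (softQ P γ u π s)
    rw [← softV_bellman P hγ0 hγ1] at h1
    have h2 : lse (softQ P γ u π s) ≤ (lse fun a => u s a + γ * avg (P s a) V) + γ * M := by
      refine lse_le_lse_add fun a => ?_
      have h3 : avg (P s a) (softV P γ u π) - avg (P s a) V ≤ M := by
        rw [← avg_sub]
        exact avg_le _ hM
      rw [softQ_eq_avg]
      linarith [mul_le_mul_of_nonneg_left h3 hγ0]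
    rw [← hV] at h2
    linarith

lemma softV_softmaxPolicy_of_optimality {u : S → A → ℝ} {V : S → ℝ}
    (hV : ∀ s, V s = lse fun a => u s a + γ * avg (P s a) V) (s : S) :
    softV P γ u (softmaxPolicy fun s a => u s a + γ * avg (P s a) V) s = V s := by
  rw [softV_eq_val hγ0 hγ1]
  symm
  refine val_unique hγ0 hγ1 P _ _ (X := V) (fun s => ?_) s
  conv_lhs => rw [hV s, ← avg_softmaxPolicy_add_entropy (fun s a => u s a + γ * avg (P s a) V) s,
    ← avg_const (softmaxPolicy (fun s a => u s a + γ * avg (P s a) V) s) (entropy _), ← avg_add]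
  refine congrArg (avg _) (funext fun a => ?_)
  simp only [smul_eq_mul]
  ring

lemma optV_eq_of_optimality {u : S → A → ℝ} {V : S → ℝ}
    (hV : ∀ s, V s = lse fun a => u s a + γ * avg (P s a) V) : optV P γ u = V := by
  funext s
  have : Nonempty (Policy S A) := ⟨softmaxPolicy fun _ _ => 0⟩
  refine le_antisymm (ciSup_le fun π => softV_le_of_optimality P hγ0 hγ1 hV π s) ?_
  rw [← softV_softmaxPolicy_of_optimality P hγ0 hγ1 hV s]
  exact le_ciSup (f := fun π => softV P γ u π s)
    ⟨V s, fun _ ⟨π, h⟩ => h ▸ softV_le_of_optimality P hγ0 hγ1 hV π s⟩ _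

lemma optV_bellman (u : S → A → ℝ) (s : S) : optV P γ u s = lse (optQ P γ u s) := by
  obtain ⟨V, hV⟩ := exists_optimality_fixedPoint P hγ0 hγ1 u
  simp only [optV_eq_of_optimality P hγ0 hγ1 hV,
    show optQ P γ u s = fun a => u s a + γ * avg (P s a) (optV P γ u) from rfl]
  exact hV s

lemma softV_le_optV (u : S → A → ℝ) (π : Policy S A) (s : S) :
    softV P γ u π s ≤ optV P γ u s :=
  softV_le_of_optimality P hγ0 hγ1 (optV_bellman P hγ0 hγ1 u) π s

lemma softV_optPolicy (u : S → A → ℝ) (s : S) :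
    softV P γ u (optPolicy P γ u) s = optV P γ u s :=
  softV_softmaxPolicy_of_optimality P hγ0 hγ1 (optV_bellman P hγ0 hγ1 u) s

lemma softQ_optPolicy (u : S → A → ℝ) (s : S) (a : A) :
    softQ P γ u (optPolicy P γ u) s a = optQ P γ u s a := by
  rw [softQ_eq_avg, optQ_eq_avg, show softV P γ u (optPolicy P γ u) = optV P γ u from
    funext fun s => softV_optPolicy P hγ0 hγ1 u s]

lemma abs_softQ_le {u : S → A → ℝ} {c : ℝ} (h : ∀ s a, 0 ≤ u s a ∧ u s a ≤ c)
    (π : Policy S A) (s : S) (a : A) :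
    |softQ P γ u π s a| ≤ (c + Real.log (Fintype.card A)) / (1 - γ) := by
  have hlog : 0 ≤ Real.log (Fintype.card A) :=
    Real.log_nonneg (by exact_mod_cast Fintype.card_pos)
  have := abs_add_mul_avg_sub_le hγ0 hγ1 (P s a) (x := u s a) (x' := 0)
    (c := c + Real.log (Fintype.card A)) (V := softV P γ u π) (V' := fun _ => 0)
    (by rw [sub_zero, abs_of_nonneg (h s a).1]; linarith [(h s a).2])
    (fun s => by rw [sub_zero]; exact abs_softV_le P hγ0 hγ1 h π s)
  rwa [avg_const, mul_zero, add_zero, sub_zero] at this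

/-- Each reward's optimal policy is tested under the other reward. -/
lemma abs_optV_sub_le {u u' : S → A → ℝ} {c : ℝ} (h : ∀ s a, |u s a - u' s a| ≤ c) (s : S) :
    |optV P γ u s - optV P γ u' s| ≤ c / (1 - γ) := by
  have h1 := abs_le.1 (abs_softV_sub_le P hγ0 hγ1 h (optPolicy P γ u) s)
  have h2 := abs_le.1 (abs_softV_sub_le P hγ0 hγ1 h (optPolicy P γ u') s)
  rw [softV_optPolicy P hγ0 hγ1] at h1 h2
  have h3 := softV_le_optV P hγ0 hγ1 u' (optPolicy P γ u) s
  have h4 := softV_le_optV P hγ0 hγ1 u (optPolicy P γ u') s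
  rw [abs_le]
  constructor <;> linarith

lemma abs_optQ_sub_le {u u' : S → A → ℝ} {c : ℝ} (h : ∀ s a, |u s a - u' s a| ≤ c) (s : S)
    (a : A) : |optQ P γ u s a - optQ P γ u' s a| ≤ c / (1 - γ) :=
  abs_add_mul_avg_sub_le hγ0 hγ1 _ (h s a) (abs_optV_sub_le P hγ0 hγ1 h)

/-- One step of approximate soft policy iteration. -/
lemma abs_softQ_softmaxPolicy_sub_optQ_le {u : S → A → ℝ} {π : Policy S A} {Q : S → A → ℝ}
    {ε e : ℝ} (hε : 0 ≤ ε) (hQ : ∀ s a, |Q s a - softQ P γ u π s a| ≤ ε)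
    (he : ∀ s a, |softQ P γ u π s a - optQ P γ u s a| ≤ e) (s : S) (a : A) :
    |softQ P γ u (softmaxPolicy Q) s a - optQ P γ u s a| ≤ γ * e + 2 * ε / (1 - γ) := by
  have himp : ∀ s, softV P γ u π s ≤ lse (softQ P γ u π s) := fun s => by
    rw [softV_bellman P hγ0 hγ1]
    exact avg_add_entropy_le_lse _ _
  -- Approximate policy improvement, measured against the exact one-step improvement `lse (softQ P γ
  -- u π s)`. One `ε` is lost replacing `Q` by the true Q-function in the average, another replacing
  -- it inside `lse`; the recursion adds `1/(1-γ)`.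
  have hnew : ∀ s, lse (softQ P γ u π s) - softV P γ u (softmaxPolicy Q) s
      ≤ 2 * ε / (1 - γ) := by
    refine le_div_of_contraction hγ1 fun M hM s => ?_
    have h1 : avg (softmaxPolicy Q s) (Q s) - ε - γ * M
        ≤ avg (softmaxPolicy Q s) (softQ P γ u (softmaxPolicy Q) s) := by
      rw [← avg_const (softmaxPolicy Q s) ε, ← avg_const (softmaxPolicy Q s) (γ * M), ← avg_sub,
        ← avg_sub]
      refine avg_mono _ fun a => ?_
      have h2 : -M ≤ avg (P s a) (softV P γ u (softmaxPolicy Q)) - avg (P s a) (softV P γ u π) := by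
        rw [← avg_sub]
        exact le_avg _ fun s' => by linarith [hM s', himp s']
      have h3 := mul_le_mul_of_nonneg_left h2 hγ0
      have h4 := (abs_le.1 (hQ s a)).2
      rw [softQ_eq_avg] at h4 ⊢
      linarith
    have h5 := avg_softmaxPolicy_add_entropy Q s
    have h6 := (abs_le.1 (abs_lse_sub_le (hQ s))).1
    rw [softV_bellman P hγ0 hγ1 u (softmaxPolicy Q)]
    linarith
  -- The optimal value is `lse` of the optimal Q-function, hence within `e` of the exact one-step
  -- improvement. The contraction factor `γ` appears only on returning to Q-functions.
  have hgap : ∀ s, |softV P γ u (softmaxPolicy Q) s - optV P γ u s| ≤ e + 2 * ε / (1 - γ) := by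
    intro s
    have h1 := softV_le_optV P hγ0 hγ1 u (softmaxPolicy Q) s
    have h2 := (abs_le.1 (abs_lse_sub_le (he s))).1
    have h3 := optV_bellman P hγ0 hγ1 u s
    have h4 := hnew s
    rw [abs_le]
    constructor <;> linarith
  have h1 := mul_le_mul_of_nonneg_left (abs_avg_sub_le (P s a) hgap) hγ0
  have h2 : γ * (2 * ε / (1 - γ)) ≤ 2 * ε / (1 - γ) :=
    mul_le_of_le_one_left (div_nonneg (by linarith) (by linarith)) hγ1.le
  rw [softQ_eq_avg, optQ_eq_avg, add_sub_add_left_eq_sub, ← mul_sub, abs_mul, abs_of_nonneg hγ0]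
  linarith

end Optimality

/-! ### Gradients and quadratic remainders. -/

section Remainder

variable {F : Type*} [NormedAddCommGroup F] [InnerProductSpace ℝ F] [CompleteSpace F]

lemma hasGradientAt_of_remainder {f : F → ℝ} {g x : F} {C : ℝ}
    (h : ∀ y, |f y - f x - inner ℝ g (y - x)| ≤ C * ‖y - x‖ ^ 2) : HasGradientAt f g x := by
  rw [hasGradientAt_iff_isLittleO]
  refine Asymptotics.IsBigO.trans_isLittleO (g := fun y => ‖y - x‖ ^ 2) ?_
    (Asymptotics.isLittleO_pow_sub_sub x one_lt_two)
  refine Asymptotics.IsBigO.of_bound C (Filter.Eventually.of_forall fun y => ?_)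
  rw [Real.norm_eq_abs, norm_pow, norm_norm]
  exact h y

lemma norm_fderiv_eq_norm_gradient (f : F → ℝ) (x : F) : ‖fderiv ℝ f x‖ = ‖gradient f x‖ := by
  rw [gradient, LinearIsometryEquiv.norm_map]

lemma norm_fderiv_sub_eq_norm_gradient_sub (f : F → ℝ) (x y : F) :
    ‖fderiv ℝ f x - fderiv ℝ f y‖ = ‖gradient f x - gradient f y‖ := by
  rw [gradient, gradient, ← map_sub, LinearIsometryEquiv.norm_map]

lemma abs_sub_le_of_norm_gradient_le {f : F → ℝ} {L : ℝ} (hf : Differentiable ℝ f)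
    (hL : ∀ x, ‖gradient f x‖ ≤ L) (x y : F) : |f y - f x| ≤ L * ‖y - x‖ :=
  Convex.norm_image_sub_le_of_norm_fderiv_le (𝕜 := ℝ) (fun z _ => hf z)
    (fun z _ => (norm_fderiv_eq_norm_gradient f z).trans_le (hL z)) convex_univ
    (Set.mem_univ x) (Set.mem_univ y)

lemma abs_remainder_le_of_lipschitz_gradient {f : F → ℝ} {L : ℝ} (hL0 : 0 ≤ L)
    (hf : Differentiable ℝ f)
    (hL : ∀ x y, ‖gradient f x - gradient f y‖ ≤ L * ‖x - y‖) (x y : F) :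
    |f y - f x - inner ℝ (gradient f x) (y - x)| ≤ L * ‖y - x‖ ^ 2 := by
  -- Mean value inequality on the ball of radius `‖y - x‖`, where the derivative deviates from that
  -- at `x` by at most `L * ‖y - x‖`. This yields `L` rather than `L / 2`, which is harmless here.
  have h := Convex.norm_image_sub_le_of_norm_fderiv_le' (𝕜 := ℝ) (f := f) (φ := fderiv ℝ f x)
    (s := Metric.closedBall x ‖y - x‖) (C := L * ‖y - x‖) (x := x) (y := y)
    (fun z _ => hf z) (fun z hz => ?_) (convex_closedBall _ _)
    (Metric.mem_closedBall_self (norm_nonneg _)) (by simp [dist_eq_norm])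
  · rw [Real.norm_eq_abs, mul_assoc, ← sq] at h
    rwa [gradient, InnerProductSpace.toDual_symm_apply]
  · rw [norm_fderiv_sub_eq_norm_gradient_sub]
    refine (hL z x).trans (mul_le_mul_of_nonneg_left ?_ hL0)
    rwa [← dist_eq_norm, ← Metric.mem_closedBall]

lemma measurable_gradient [MeasurableSpace F] [BorelSpace F] (f : F → ℝ) :
    Measurable (gradient f) :=
  (InnerProductSpace.toDual ℝ F).symm.continuous.measurable.comp (measurable_fderiv ℝ f)

end Remainder

/-- Rewards with values in `[0, C_r]` and an `L_g`-Lipschitz gradient bounded by `L_r`. -/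
structure IsRegularReward {S A : Type*} {p : ℕ} (r : Param p → S → A → ℝ)
    (C_r L_r L_g : ℝ) : Prop where
  bounds : ∀ θ s a, 0 ≤ r θ s a ∧ r θ s a ≤ C_r
  differentiable : ∀ s a, Differentiable ℝ fun θ => r θ s a
  norm_gradient_le : ∀ s a θ, ‖gradient (fun θ' => r θ' s a) θ‖ ≤ L_r
  lipschitz_gradient : ∀ s a θ₁ θ₂,
    ‖gradient (fun θ' => r θ' s a) θ₁ - gradient (fun θ' => r θ' s a) θ₂‖ ≤ L_g * ‖θ₁ - θ₂‖
  pos_L_r : 0 < L_r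
  pos_L_g : 0 < L_g

/-! ### Smoothness of the surrogate likelihood. -/

section Gradient

variable {S A : Type*} {p N : ℕ} {γ C_r L_r L_g : ℝ} {r : Param p → S → A → ℝ}

/-- The table of reward gradients. -/
def rewardGrad (r : Param p → S → A → ℝ) (θ : Param p) (s : S) (a : A) : Param p :=
  gradient (fun θ' => r θ' s a) θ

lemma IsRegularReward.abs_sub_le (hr : IsRegularReward r C_r L_r L_g) (θ θ' : Param p) (s : S)
    (a : A) : |r θ' s a - r θ s a| ≤ L_r * ‖θ' - θ‖ :=
  abs_sub_le_of_norm_gradient_le (hr.differentiable s a) (hr.norm_gradient_le s a) θ θ'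

lemma IsRegularReward.abs_remainder_le (hr : IsRegularReward r C_r L_r L_g) (θ θ' : Param p)
    (s : S) (a : A) :
    |r θ' s a - r θ s a - inner ℝ (θ' - θ) (rewardGrad r θ s a)| ≤ L_g * ‖θ' - θ‖ ^ 2 := by
  rw [real_inner_comm]
  exact abs_remainder_le_of_lipschitz_gradient hr.pos_L_g.le (hr.differentiable s a)
    (hr.lipschitz_gradient s a) θ θ'

variable (hr : IsRegularReward r C_r L_r L_g) (hγ0 : 0 ≤ γ) (hγ1 : γ < 1)

include hr hγ0 hγ1

lemma norm_discountedGrad_le (θ : Param p) (τ : Traj S A) :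
    ‖discountedGrad γ r θ τ‖ ≤ L_r / (1 - γ) :=
  norm_tsum_discount_le hγ0 hγ1 fun _ => hr.norm_gradient_le _ _ _

lemma hasSum_discountedGrad (θ : Param p) (τ : Traj S A) :
    HasSum (fun t => γ ^ t • rewardGrad r θ (τ t).1 (τ t).2) (discountedGrad γ r θ τ) :=
  (summable_discount hγ0 hγ1 fun _ => hr.norm_gradient_le _ _ _).hasSum

lemma abs_return_remainder_le (θ θ' : Param p) (τ : Traj S A) :
    |∑' t : ℕ, γ ^ t * r θ' (τ t).1 (τ t).2 - ∑' t : ℕ, γ ^ t * r θ (τ t).1 (τ t).2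
        - inner ℝ (θ' - θ) (discountedGrad γ r θ τ)|
      ≤ L_g * ‖θ' - θ‖ ^ 2 / (1 - γ) := by
  have hs : ∀ θ, Summable fun t => γ ^ t * r θ (τ t).1 (τ t).2 := fun θ =>
    summable_discount (E := ℝ) (c := C_r) hγ0 hγ1 fun t => by
      rw [Real.norm_of_nonneg (hr.bounds _ _ _).1]
      exact (hr.bounds _ _ _).2
  have hi := (innerSL ℝ (θ' - θ)).hasSum (hasSum_discountedGrad hr hγ0 hγ1 θ τ)
  have h := ((hs θ').hasSum.sub (hs θ).hasSum).sub hi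
  simp only [innerSL_apply_apply] at h
  rw [← h.tsum_eq]
  have h1 := norm_tsum_discount_le (E := ℝ) hγ0 hγ1
    fun t => hr.abs_remainder_le θ θ' (τ t).1 (τ t).2
  refine (le_of_eq ?_).trans h1
  rw [Real.norm_eq_abs]
  congr 2
  funext t
  simp only [inner_smul_right, smul_eq_mul]
  ring

variable [Fintype S] [MeasurableSpace S] [DiscreteMeasurableSpace S]
variable [Fintype A] [Nonempty A] [MeasurableSpace A] [DiscreteMeasurableSpace A]
variable (P : S → A → PMF S) (ρ : PMF S) (D : Fin N → Traj S A)

omit hr hγ0 hγ1 in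
/-- The gradient in `θ` of the optimal soft value function. -/
def optGrad (P : S → A → PMF S) (γ : ℝ) (r : Param p → S → A → ℝ) (θ : Param p) : S → Param p :=
  val P γ (optPolicy P γ (r θ)) (rewardGrad r θ)

omit hr hγ0 hγ1 in
/-- The gradient of the surrogate log-likelihood. -/
def surrogateGrad (P : S → A → PMF S) (ρ : PMF S) (γ : ℝ) (r : Param p → S → A → ℝ)
    (D : Fin N → Traj S A) (θ : Param p) : Param p :=
  (1 / (N : ℝ)) • ∑ i, discountedGrad γ r θ (D i) - avg ρ (optGrad P γ r θ)

/-- A chain of Lipschitz maps: parameter to reward (`L_r`), to optimal Q-function (`1/(1-γ)`), to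
log-policy (`2`), to policy (`1`). -/
lemma abs_optPolicy_sub_le (θ θ' : Param p) (s : S) (a : A) :
    |(optPolicy P γ (r θ') s a).toReal - (optPolicy P γ (r θ) s a).toReal|
      ≤ 2 * (L_r * ‖θ' - θ‖ / (1 - γ)) :=
  abs_softmaxPolicy_sub_le (fun s a => abs_logPolicy_softmaxPolicy_sub_le
    (abs_optQ_sub_le P hγ0 hγ1 (hr.abs_sub_le θ θ')) (s, a)) s a

/-- The quadratic remainder of the optimal soft value function, by the envelope argument. -/
lemma abs_optV_remainder_le (θ θ' : Param p) (s : S) :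
    |optV P γ (r θ') s - optV P γ (r θ) s - inner ℝ (θ' - θ) (optGrad P γ r θ s)|
      ≤ L_g * ‖θ' - θ‖ ^ 2 / (1 - γ)
        + Fintype.card A * (2 * (L_r * ‖θ' - θ‖ / (1 - γ)) * (L_r * ‖θ' - θ‖ / (1 - γ)))
          / (1 - γ) := by
  set π := optPolicy P γ (r θ)
  set π' := optPolicy P γ (r θ')
  let d : S → A → ℝ := fun s a => r θ' s a - r θ s a
  have hd : ∀ s a, ‖d s a‖ ≤ L_r * ‖θ' - θ‖ := hr.abs_sub_le θ θ'
  have hlin : |val P γ π d s - inner ℝ (θ' - θ) (optGrad P γ r θ s)|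
      ≤ L_g * ‖θ' - θ‖ ^ 2 / (1 - γ) := by
    rw [optGrad, ← val_inner hγ0 hγ1, ← val_sub hγ0 hγ1]
    exact norm_val_le (E := ℝ) hγ0 hγ1 P π _ (hr.abs_remainder_le θ θ') s
  have hpol : |val P γ π' d s - val P γ π d s| ≤ Fintype.card A *
      (2 * (L_r * ‖θ' - θ‖ / (1 - γ)) * (L_r * ‖θ' - θ‖ / (1 - γ))) / (1 - γ) :=
    norm_val_sub_val_le (E := ℝ) hγ0 hγ1 P π' d π hd (abs_optPolicy_sub_le hr hγ0 hγ1 P θ θ') s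
  -- The envelope squeeze: `π` competes at `θ'` and `π'` at `θ`, so the increment of the optimal
  -- value lies between the sums of `d` under `π` and under `π'`. By `hpol` these differ to second
  -- order, since `d` and `π' - π` are both first order.
  have hlow : optV P γ (r θ) s + val P γ π d s ≤ optV P γ (r θ') s := by
    rw [← softV_sub_softV P hγ0 hγ1, softV_optPolicy P hγ0 hγ1, add_sub_cancel]
    exact softV_le_optV P hγ0 hγ1 _ _ s
  have hupp : optV P γ (r θ') s ≤ optV P γ (r θ) s + val P γ π' d s := by
    have := softV_le_optV P hγ0 hγ1 (r θ) π' s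
    rw [← softV_sub_softV P hγ0 hγ1, softV_optPolicy P hγ0 hγ1]
    linarith
  have h0 := (abs_nonneg _).trans hpol
  rw [abs_le] at hlin hpol ⊢
  constructor <;> linarith [hlin.1, hlin.2, hpol.1, hpol.2]

omit [MeasurableSpace S] [DiscreteMeasurableSpace S] [Fintype S]
  [Fintype A] [Nonempty A] [MeasurableSpace A] [DiscreteMeasurableSpace A] hr hγ0 hγ1 in
lemma norm_mean_le {E : Type*} [NormedAddCommGroup E] [NormedSpace ℝ E] (hN : 0 < N)
    {x : Fin N → E} {c : ℝ} (h : ∀ i, ‖x i‖ ≤ c) : ‖(1 / (N : ℝ)) • ∑ i, x i‖ ≤ c := by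
  have hN' : (0 : ℝ) < N := by exact_mod_cast hN
  rw [norm_smul, Real.norm_of_nonneg (by positivity), one_div, inv_mul_le_iff₀ hN']
  refine (norm_sum_le _ _).trans ((Finset.sum_le_card_nsmul _ _ _ fun i _ => h i).trans ?_)
  simp

/-- The smoothness constant of the surrogate log-likelihood. -/
def smoothConst (A : Type*) [Fintype A] (γ L_r L_g : ℝ) : ℝ :=
  2 * (L_g / (1 - γ)) + Fintype.card A * (2 * (L_r / (1 - γ)) * (L_r / (1 - γ))) / (1 - γ)

lemma abs_surrogate_remainder_le (hN : 0 < N) (θ θ' : Param p) :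
    |surrogate P ρ γ r D θ' - surrogate P ρ γ r D θ
        - inner ℝ (surrogateGrad P ρ γ r D θ) (θ' - θ)|
      ≤ smoothConst A γ L_r L_g * ‖θ' - θ‖ ^ 2 := by
  have h1 := norm_mean_le (E := ℝ) hN fun i => abs_return_remainder_le hr hγ0 hγ1 θ θ' (D i)
  have h2 := norm_avg_le (E := ℝ) ρ fun s => abs_optV_remainder_le hr hγ0 hγ1 P θ θ' s
  rw [avg_sub, avg_sub, avg_inner] at h2
  rw [Finset.sum_sub_distrib, Finset.sum_sub_distrib, ← inner_sum, smul_sub, smul_sub,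
    ← inner_smul_right_eq_smul] at h1
  rw [real_inner_comm, surrogateGrad, inner_sub_right]
  have h3 : surrogate P ρ γ r D θ' - surrogate P ρ γ r D θ
      - (inner ℝ (θ' - θ) ((1 / (N : ℝ)) • ∑ i, discountedGrad γ r θ (D i))
        - inner ℝ (θ' - θ) (avg ρ (optGrad P γ r θ)))
      = ((1 / (N : ℝ)) • ∑ i, ∑' t : ℕ, γ ^ t * r θ' (D i t).1 (D i t).2
          - (1 / (N : ℝ)) • ∑ i, ∑' t : ℕ, γ ^ t * r θ (D i t).1 (D i t).2
          - inner ℝ (θ' - θ) ((1 / (N : ℝ)) • ∑ i, discountedGrad γ r θ (D i)))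
        - (avg ρ (optV P γ (r θ')) - avg ρ (optV P γ (r θ))
          - inner ℝ (θ' - θ) (avg ρ (optGrad P γ r θ))) := by
    simp only [surrogate, avg, smul_eq_mul]
    ring
  rw [h3]
  refine (norm_sub_le (E := ℝ) _ _).trans ((add_le_add h1 h2).trans_eq ?_)
  rw [smoothConst]
  ring

lemma hasGradientAt_surrogate (hN : 0 < N) (θ : Param p) :
    HasGradientAt (surrogate P ρ γ r D) (surrogateGrad P ρ γ r D θ) θ :=
  hasGradientAt_of_remainder fun θ' => abs_surrogate_remainder_le hr hγ0 hγ1 P ρ D hN θ θ'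

lemma norm_surrogateGrad_le (hN : 0 < N) (θ : Param p) :
    ‖surrogateGrad P ρ γ r D θ‖ ≤ 2 * (L_r / (1 - γ)) := by
  rw [two_mul]
  exact (norm_sub_le _ _).trans (add_le_add
    (norm_mean_le hN fun i => norm_discountedGrad_le hr hγ0 hγ1 θ (D i))
    (norm_avg_le ρ fun s => norm_val_le hγ0 hγ1 P _ _ (fun s a => hr.norm_gradient_le s a θ) s))

lemma abs_surrogate_le (hN : 0 < N) (θ : Param p) :
    |surrogate P ρ γ r D θ|
      ≤ C_r / (1 - γ) + (C_r + Real.log (Fintype.card A)) / (1 - γ) := by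
  refine (norm_sub_le (E := ℝ) _ _).trans (add_le_add
    (norm_mean_le (E := ℝ) hN fun i => norm_tsum_discount_le (E := ℝ) hγ0 hγ1 fun t => ?_)
    (norm_avg_le (E := ℝ) ρ fun s => ?_))
  · rw [Real.norm_of_nonneg (hr.bounds _ _ _).1]
    exact (hr.bounds _ _ _).2
  · rw [← softV_optPolicy P hγ0 hγ1]
    exact abs_softV_le P hγ0 hγ1 (hr.bounds θ) _ s

end Gradient

/-! ### Integration against conditional laws. -/

section Sampling

variable {Ω : Type*} {m mΩ : MeasurableSpace Ω} {μ : Measure Ω} [IsProbabilityMeasure μ] {c : ℝ}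

/-- Discounted sums of uniformly bounded random variables can be integrated term by term. -/
lemma hasSum_integral_discount {γ : ℝ} (hγ0 : 0 ≤ γ) (hγ1 : γ < 1) {F : ℕ → Ω → ℝ}
    (hF : ∀ t, Integrable (F t) μ) (hc : ∀ t, ∀ᵐ ω ∂μ, |F t ω| ≤ c) :
    Integrable (fun ω => ∑' t : ℕ, γ ^ t * F t ω) μ ∧
      HasSum (fun t => γ ^ t * ∫ ω, F t ω ∂μ) (∫ ω, ∑' t : ℕ, γ ^ t * F t ω ∂μ) := by
  have hall := ae_all_iff.2 hc
  have hsum := hasSum_integral_of_summable_integral_norm (μ := μ)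
    (F := fun (t : ℕ) ω => γ ^ t * F t ω) (fun t => (hF t).const_mul _) (by
      have h1 : ∀ t, ∫ ω, ‖γ ^ t * F t ω‖ ∂μ = γ ^ t • ∫ ω, |F t ω| ∂μ := fun t => by
        rw [smul_eq_mul, ← integral_const_mul]
        simp_rw [norm_mul, norm_pow, Real.norm_of_nonneg hγ0, Real.norm_eq_abs]
      simp_rw [h1]
      refine summable_discount (c := c) hγ0 hγ1 fun t => ?_
      refine (norm_integral_le_of_norm_le_const (C := c) ?_).trans (by simp)
      filter_upwards [hc t] with ω hω
      rwa [Real.norm_eq_abs, abs_abs])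
  simp_rw [integral_const_mul] at hsum
  refine ⟨Integrable.of_bound ?_ (c / (1 - γ)) ?_, hsum⟩
  · refine aestronglyMeasurable_of_tendsto_ae Filter.atTop
      (f := fun n ω => ∑ t ∈ Finset.range n, γ ^ t * F t ω) (fun n => ?_) ?_
    · exact Finset.aestronglyMeasurable_fun_sum _ fun t _ =>
        (hF t).aestronglyMeasurable.const_mul _
    · filter_upwards [hall] with ω hω
      exact (summable_discount (E := ℝ) hγ0 hγ1 hω).hasSum.tendsto_sum_nat
  · filter_upwards [hall] with ω hω
    exact norm_tsum_discount_le (E := ℝ) hγ0 hγ1 hω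

/-- Pulling a bounded known factor out of a conditional probability. -/
lemma integral_mul_indicator_of_condExp (hm : m ≤ mΩ) {X : Ω → ℝ} (hX : StronglyMeasurable[m] X)
    (hc : ∀ ω, |X ω| ≤ c) {B : Set Ω} (hB : MeasurableSet B) {q : Ω → ℝ}
    (hq : μ[B.indicator (fun _ => (1 : ℝ)) | m] =ᵐ[μ] q) :
    Integrable (fun ω => X ω * q ω) μ ∧
      ∫ ω, X ω * B.indicator (fun _ => (1 : ℝ)) ω ∂μ = ∫ ω, X ω * q ω ∂μ := by
  have hi : Integrable (B.indicator fun _ => (1 : ℝ)) μ := (integrable_const 1).indicator hB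
  have h1 := condExp_stronglyMeasurable_mul_of_bound hm hX hi c (Filter.Eventually.of_forall hc)
  have h2 : μ[X * B.indicator (fun _ => (1 : ℝ)) | m] =ᵐ[μ] fun ω => X ω * q ω := by
    filter_upwards [h1, hq] with ω h3 h4
    rw [h3, Pi.mul_apply, h4]
  -- No measurability of `q` is assumed; integrability is inherited from the conditional
  -- expectation, to which the product is almost surely equal.
  refine ⟨integrable_condExp.congr h2, ?_⟩
  rw [← integral_congr_ae h2, integral_condExp hm]
  rfl

/-- The mean of a known family of random variables evaluated at a random index. -/
lemma integral_eval_of_condExp {Z : Type*} [Fintype Z] [MeasurableSpace Z]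
    [MeasurableSingletonClass Z] (hm : m ≤ mΩ) {X : Z → Ω → ℝ}
    (hX : ∀ z, StronglyMeasurable[m] (X z)) (hc : ∀ z ω, |X z ω| ≤ c) {J : Ω → Z}
    (hJ : Measurable J) {q : Z → Ω → ℝ}
    (hq : ∀ z, μ[(J ⁻¹' {z}).indicator (fun _ => (1 : ℝ)) | m] =ᵐ[μ] q z) :
    Integrable (fun ω => X (J ω) ω) μ ∧ Integrable (fun ω => ∑ z, X z ω * q z ω) μ ∧
      ∫ ω, X (J ω) ω ∂μ = ∫ ω, ∑ z, X z ω * q z ω ∂μ := by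
  classical
  have hB : ∀ z, MeasurableSet (J ⁻¹' {z}) := fun z => hJ (measurableSet_singleton z)
  have h := fun z => integral_mul_indicator_of_condExp (μ := μ) hm (hX z) (hc z) (hB z) (hq z)
  have hi : ∀ z, Integrable (fun ω => X z ω * (J ⁻¹' {z}).indicator (fun _ => (1 : ℝ)) ω) μ :=
    fun z => Integrable.of_bound (((hX z).mono hm).aestronglyMeasurable.mul
      (stronglyMeasurable_const.indicator (hB z)).aestronglyMeasurable) c
      (Filter.Eventually.of_forall fun ω => by
        have h0 := (abs_nonneg _).trans (hc z ω)
        by_cases hω : ω ∈ J ⁻¹' {z}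
        · simpa [hω] using hc z ω
        · simpa [hω] using h0)
  have heq : (fun ω => X (J ω) ω)
      = fun ω => ∑ z, X z ω * (J ⁻¹' {z}).indicator (fun _ => (1 : ℝ)) ω := by
    funext ω
    simp [Set.indicator_apply]
  rw [heq]
  refine ⟨integrable_finsetSum _ fun z _ => hi z, integrable_finsetSum _ fun z _ => (h z).1, ?_⟩
  rw [integral_finsetSum _ fun z _ => hi z, integral_finsetSum _ fun z _ => (h z).1]
  exact Finset.sum_congr rfl fun z _ => (h z).2

end Sampling

/-! ### Trajectories sampled from a random policy. -/

section Agent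

variable {S A : Type*} [Fintype S] [MeasurableSpace S] [DiscreteMeasurableSpace S]
variable [Fintype A] [MeasurableSpace A] [DiscreteMeasurableSpace A]

lemma sum_mul_trajLaw_real (P : S → A → PMF S) (ν : PMF S) (π : Policy S A) (f : S → A → ℝ)
    (t : ℕ) :
    ∑ z : S × A, f z.1 z.2 * (trajLaw P ν π).real ((fun τ => τ t) ⁻¹' {z})
      = avg ν fun s => avg (π s) ((stepOp P π)^[t] f s) := by
  classical
  have hB : ∀ z : S × A, MeasurableSet ((fun τ : Traj S A => τ t) ⁻¹' {z}) := fun z =>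
    measurable_pi_apply t (measurableSet_singleton z)
  rw [← integral_eval]
  have heq : (fun τ : Traj S A => f (τ t).1 (τ t).2)
      = fun τ => ∑ z : S × A, ((fun τ : Traj S A => τ t) ⁻¹' {z}).indicator
          (fun _ => f z.1 z.2) τ := by
    funext τ
    simp [Set.indicator_apply]
  rw [heq, integral_finsetSum _ fun z _ => (integrable_const _).indicator (hB z)]
  refine Finset.sum_congr rfl fun z _ => ?_
  rw [integral_indicator_const _ (hB z), smul_eq_mul, mul_comm]

variable {Ω : Type*} {m mΩ : MeasurableSpace Ω} {μ : Measure Ω} [IsProbabilityMeasure μ]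
variable {γ c : ℝ} (hγ0 : 0 ≤ γ) (hγ1 : γ < 1) (P : S → A → PMF S) (ν : PMF S)

include hγ0 hγ1

/-- The mean discounted sum along a trajectory sampled, given `m`, from a random policy. -/
lemma integral_discounted_of_condLaw (hm : m ≤ mΩ) {X : Ω → S → A → ℝ}
    (hX : ∀ s a, StronglyMeasurable[m] fun ω => X ω s a) (hc : ∀ ω s a, |X ω s a| ≤ c)
    {T : Ω → Traj S A} (hT : Measurable T) {π : Ω → Policy S A}
    (hlaw : ∀ B : Set (Traj S A), MeasurableSet B →
      μ[(T ⁻¹' B).indicator (fun _ => (1 : ℝ)) | m] =ᵐ[μ] fun ω => (trajLaw P ν (π ω)).real B) :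
    Integrable (fun ω => ∑' t : ℕ, γ ^ t * X ω (T ω t).1 (T ω t).2) μ ∧
      Integrable (fun ω => avg ν (val P γ (π ω) (X ω))) μ ∧
      ∫ ω, ∑' t : ℕ, γ ^ t * X ω (T ω t).1 (T ω t).2 ∂μ
        = ∫ ω, avg ν (val P γ (π ω) (X ω)) ∂μ := by
  -- At a fixed time only the current pair matters, and it takes finitely many values. The
  -- conditional law is thus used only on events `T ω t = z`, and no measurable structure on
  -- policies is needed.
  have h := fun t : ℕ => integral_eval_of_condExp (μ := μ) (Z := S × A) hm
    (X := fun z ω => X ω z.1 z.2) (fun z => hX z.1 z.2) (fun z ω => hc ω z.1 z.2)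
    (J := fun ω => T ω t) ((measurable_pi_apply t).comp hT)
    (q := fun z ω => (trajLaw P ν (π ω)).real ((fun τ => τ t) ⁻¹' {z}))
    (fun z => hlaw _ (measurable_pi_apply t (measurableSet_singleton z)))
  simp_rw [sum_mul_trajLaw_real] at h
  have h1 := hasSum_integral_discount hγ0 hγ1 (fun t => (h t).1)
    (fun t => Filter.Eventually.of_forall fun ω => hc ω _ _)
  have h2 := hasSum_integral_discount hγ0 hγ1 (c := c) (fun t => (h t).2.1)
    (fun t => Filter.Eventually.of_forall fun ω => norm_avg_le (E := ℝ) ν fun s =>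
      norm_avg_le (E := ℝ) _ fun a => norm_iterate_stepOp_le P (π ω) (hc ω) t s a)
  have h3 : ∀ ω, ∑' t : ℕ, γ ^ t * avg ν (fun s => avg (π ω s) ((stepOp P (π ω))^[t] (X ω) s))
      = avg ν (val P γ (π ω) (X ω)) := fun ω => by
    rw [← (hasSum_avg ν fun s => hasSum_val hγ0 hγ1 P (π ω) (X ω) s).tsum_eq]
    exact tsum_congr fun t => (avg_smul ν _ _).symm
  simp_rw [h3, ← fun t => (h t).2.2] at h2
  exact ⟨h1.1, h2.1, h1.2.unique h2.2⟩

end Agent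

/-! ### Measurability in the parameter. -/

section Measurability

lemma measurable_rewardGrad {S A : Type*} {p : ℕ} (r : Param p → S → A → ℝ) (s : S) (a : A) :
    Measurable fun θ => rewardGrad r θ s a :=
  measurable_gradient _

variable {S A : Type*} [Fintype S] [MeasurableSpace S] [DiscreteMeasurableSpace S]
variable [Fintype A] [MeasurableSpace A] [DiscreteMeasurableSpace A]
variable {p : ℕ} {γ C_r L_r L_g : ℝ} {r : Param p → S → A → ℝ}

lemma measurable_discountedGrad (hr : IsRegularReward r C_r L_r L_g) (hγ0 : 0 ≤ γ)
    (hγ1 : γ < 1) : Measurable fun x : Param p × Traj S A => discountedGrad γ r x.1 x.2 := by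
  have hG : Measurable fun y : Param p × (S × A) => rewardGrad r y.1 y.2.1 y.2.2 :=
    measurable_from_prod_countable_left fun z => measurable_rewardGrad r z.1 z.2
  refine (StronglyMeasurable.hasSum (f := fun (t : ℕ) (x : Param p × Traj S A) =>
    γ ^ t • rewardGrad r x.1 (x.2 t).1 (x.2 t).2) (fun t => ?_) fun x =>
      hasSum_discountedGrad hr hγ0 hγ1 x.1 x.2).measurable
  have h2 : Measurable fun x : Param p × Traj S A => (x.1, x.2 t) :=
    measurable_fst.prodMk ((measurable_pi_apply t).comp measurable_snd)
  exact ((hG.comp h2).const_smul (γ ^ t)).stronglyMeasurable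

variable [Nonempty A]

omit [MeasurableSpace A] [DiscreteMeasurableSpace A] in
lemma measurable_logPolicy_softmaxPolicy {S : Type*} {Ω : Type*} [MeasurableSpace Ω]
    {Q : Ω → S → A → ℝ} (hQ : ∀ s a, Measurable fun ω => Q ω s a) :
    Measurable fun ω => logPolicy (softmaxPolicy (Q ω)) := by
  refine measurable_pi_iff.2 fun z => ?_
  simp_rw [logPolicy_softmaxPolicy, lse]
  exact (hQ _ _).sub (Real.measurable_log.comp
    (Finset.measurable_fun_sum _ fun a _ => Real.measurable_exp.comp (hQ _ a)))

lemma measurable_optQ (hr : IsRegularReward r C_r L_r L_g) (hγ0 : 0 ≤ γ) (hγ1 : γ < 1)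
    (P : S → A → PMF S) (s : S) (a : A) : Measurable fun θ => optQ P γ (r θ) s a := by
  refine (LipschitzWith.of_dist_le_mul (K := (L_r / (1 - γ)).toNNReal)
    fun θ θ' => ?_).continuous.measurable
  rw [Real.coe_toNNReal _ (div_nonneg hr.pos_L_r.le (by linarith)), Real.dist_eq, dist_eq_norm,
    div_mul_eq_mul_div]
  exact abs_optQ_sub_le P hγ0 hγ1 (hr.abs_sub_le θ' θ) s a

end Measurability

/-! ### Error recursion and mean ascent along a run. -/

section Run

variable {S A : Type*} [Fintype S] [MeasurableSpace S] [DiscreteMeasurableSpace S]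
variable [Fintype A] [Nonempty A] [MeasurableSpace A] [DiscreteMeasurableSpace A]
variable {p N : ℕ} {P : S → A → PMF S} {ρ : PMF S} {γ C_r L_r L_g : ℝ}
variable {r : Param p → S → A → ℝ} {D : Fin N → Traj S A} {θ₀ : Param p} {π₀ : Policy S A}
variable {α ε : ℝ} {K : ℕ} {Ω : Type*} [mΩ : MeasurableSpace Ω] {μ : Measure Ω}
variable {ℱ : Filtration ℕ mΩ} {θ : ℕ → Ω → Param p} {π : ℕ → Ω → Policy S A}
variable {Qhat : ℕ → Ω → S → A → ℝ} {I : ℕ → Ω → Fin N} {τ : ℕ → Ω → Traj S A}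
variable (hrun : IsRun P ρ γ r D θ₀ π₀ α ε K μ ℱ θ π Qhat I τ)
variable (hr : IsRegularReward r C_r L_r L_g) (hγ0 : 0 ≤ γ) (hγ1 : γ < 1)
variable (hα : 0 ≤ α) (hε : 0 ≤ ε)

/-- The bound on the increments of the reward parameter. -/
def stepBound (γ L_r α : ℝ) : ℝ := α * (2 * (L_r / (1 - γ)))

/-- The error added to the soft Q-function in one iteration. -/
def iterError (γ L_r α ε : ℝ) : ℝ :=
  2 * ε / (1 - γ) + 2 * (L_r * stepBound γ L_r α / (1 - γ))

/-- The bound on the soft values. -/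
def valueBound (A : Type*) [Fintype A] (γ C_r : ℝ) : ℝ :=
  (C_r + Real.log (Fintype.card A)) / (1 - γ)

/-- The bound on the error of the policy after iteration `k`. -/
def policyError (A : Type*) [Fintype A] (γ C_r L_r α ε : ℝ) (k : ℕ) : ℝ :=
  2 * (ε + (γ ^ k * (2 * valueBound A γ C_r) + iterError γ L_r α ε / (1 - γ)))

include hr hγ0 hγ1 hrun

lemma IsRun.measurable_param {k : ℕ} (hk : k ≤ K) : Measurable[ℱ k] (θ k) := by
  induction k with
  | zero =>
    rw [show θ 0 = fun _ => θ₀ from funext hrun.init_param]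
    exact measurable_const
  | succ k ih =>
    have h1 : Measurable[ℱ (k + 1)] (θ k) := (ih (by omega)).mono (ℱ.mono (Nat.le_succ k)) le_rfl
    have h2 := hrun.expert_measurable k (by omega)
    have h3 := hrun.agent_measurable k (by omega)
    have h4 : Measurable[ℱ (k + 1)] fun ω => D (I k ω) := (measurable_of_finite D).comp h2
    have hd := measurable_discountedGrad hr hγ0 hγ1
    rw [show θ (k + 1) = _ from funext (hrun.update k (by omega))]
    exact h1.add (((hd.comp (h1.prodMk h4)).sub (hd.comp (h1.prodMk h3))).const_smul α)

include hα in
lemma IsRun.norm_step_le {k : ℕ} (hk : k < K) (ω : Ω) :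
    ‖θ (k + 1) ω - θ k ω‖ ≤ stepBound γ L_r α := by
  rw [hrun.update k hk, add_sub_cancel_left, norm_smul, Real.norm_of_nonneg hα, stepBound, two_mul]
  exact mul_le_mul_of_nonneg_left ((norm_sub_le _ _).trans (add_le_add
    (norm_discountedGrad_le hr hγ0 hγ1 _ _) (norm_discountedGrad_le hr hγ0 hγ1 _ _))) hα

include hα hε in
lemma IsRun.ae_softQ_error : ∀ᵐ ω ∂μ, ∀ k < K, ∀ s a,
    |softQ P γ (r (θ k ω)) (π k ω) s a - optQ P γ (r (θ k ω)) s a|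
      ≤ γ ^ k * (2 * valueBound A γ C_r) + iterError γ L_r α ε / (1 - γ) := by
  have hev : ∀ᵐ ω ∂μ, ∀ k, k < K → ∀ s a,
      |Qhat k ω s a - softQ P γ (r (θ k ω)) (π k ω) s a| ≤ ε :=
    ae_all_iff.2 fun k => ae_all_iff.2 fun hk => hrun.eval_error k hk
  have hg : 0 < 1 - γ := by linarith
  have hB : 0 ≤ stepBound γ L_r α :=
    mul_nonneg hα (mul_nonneg zero_le_two (div_nonneg hr.pos_L_r.le hg.le))
  have hd : 0 ≤ iterError γ L_r α ε := by
    have := hr.pos_L_r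
    unfold iterError
    positivity
  filter_upwards [hev] with ω hω k hk
  induction k with
  | zero =>
    intro s a
    have h1 := abs_softQ_le P hγ0 hγ1 (hr.bounds (θ 0 ω)) (π 0 ω) s a
    have h2 := abs_softQ_le P hγ0 hγ1 (hr.bounds (θ 0 ω)) (optPolicy P γ (r (θ 0 ω))) s a
    rw [softQ_optPolicy P hγ0 hγ1] at h2
    have h3 : 0 ≤ iterError γ L_r α ε / (1 - γ) := div_nonneg hd hg.le
    have h4 := (abs_sub _ _).trans (add_le_add h1 h2)
    rw [pow_zero, valueBound]
    linarith
  | succ k ih =>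
    intro s a
    have hk' : k < K := by omega
    -- The parameter step moves both the Q-function of `π_{k+1}` and the optimal one, whence the
    -- factor `2` in the drift part of `iterError`.
    have hθ : ∀ s a, |r (θ (k + 1) ω) s a - r (θ k ω) s a| ≤ L_r * stepBound γ L_r α :=
      fun s a => (hr.abs_sub_le _ _ s a).trans
        (mul_le_mul_of_nonneg_left (hrun.norm_step_le hr hγ0 hγ1 hα hk' ω) hr.pos_L_r.le)
    have h1 := abs_softQ_sub_le P hγ0 hγ1 hθ (π (k + 1) ω) s a
    have h2 := abs_optQ_sub_le P hγ0 hγ1 hθ s a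
    have h3 := abs_softQ_softmaxPolicy_sub_optQ_le P hγ0 hγ1 hε (hω k hk') (ih hk') s a
    rw [← hrun.improvement k hk' ω] at h3
    -- `iterError / (1 - γ)` is the fixed point of `e ↦ γ e + iterError`, so only the transient
    -- decays.
    have h4 : γ * (iterError γ L_r α ε / (1 - γ)) + iterError γ L_r α ε
        = iterError γ L_r α ε / (1 - γ) := by
      field_simp
      ring
    have h5 : iterError γ L_r α ε
        = 2 * ε / (1 - γ) + 2 * (L_r * stepBound γ L_r α / (1 - γ)) := rfl
    rw [pow_succ', ← h4]
    rw [abs_le] at h1 h2 h3 ⊢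
    constructor <;> linarith [h1.1, h1.2, h2.1, h2.2, h3.1, h3.2]

include hα hε in
lemma IsRun.ae_logPolicy_error : ∀ᵐ ω ∂μ, ∀ k < K,
    ‖logPolicy (π (k + 1) ω) - logPolicy (optPolicy P γ (r (θ k ω)))‖
      ≤ policyError A γ C_r L_r α ε k := by
  have hev : ∀ᵐ ω ∂μ, ∀ k, k < K → ∀ s a,
      |Qhat k ω s a - softQ P γ (r (θ k ω)) (π k ω) s a| ≤ ε :=
    ae_all_iff.2 fun k => ae_all_iff.2 fun hk => hrun.eval_error k hk
  filter_upwards [hev, hrun.ae_softQ_error hr hγ0 hγ1 hα hε] with ω h1 h2 k hk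
  -- The new policy is the softmax of `Qhat k` and is compared with the optimum at the old parameter
  -- `θ k`, so the error at index `k` enters, plus one `ε` for the evaluation.
  have h3 : ∀ s a, |Qhat k ω s a - optQ P γ (r (θ k ω)) s a|
      ≤ ε + (γ ^ k * (2 * valueBound A γ C_r) + iterError γ L_r α ε / (1 - γ)) := fun s a =>
    (abs_sub_le _ _ _).trans (add_le_add (h1 k hk s a) (h2 k hk s a))
  have h4 := abs_logPolicy_softmaxPolicy_sub_le h3
  rw [← hrun.improvement k hk ω] at h4
  obtain ⟨s⟩ : Nonempty S := ⟨(ρ.support_nonempty).some⟩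
  have : Nonempty (S × A) := ⟨(s, Classical.arbitrary A)⟩
  exact (pi_norm_le_iff_of_nonempty _).2 h4

variable [IsProbabilityMeasure μ]

include hα hε in
lemma IsRun.integrable_logPolicy_error {k : ℕ} (hk : k < K) :
    Integrable (fun ω => ‖logPolicy (π (k + 1) ω) - logPolicy (optPolicy P γ (r (θ k ω)))‖) μ := by
  have hθ : Measurable (θ k) := (hrun.measurable_param hr hγ0 hγ1 hk.le).mono (ℱ.le k) le_rfl
  have h1 : Measurable fun ω => logPolicy (π (k + 1) ω) := by
    simp_rw [hrun.improvement k hk]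
    exact measurable_logPolicy_softmaxPolicy fun s a =>
      (hrun.eval_measurable k hk s a).mono (ℱ.le k) le_rfl
  have h2 : Measurable fun ω => logPolicy (optPolicy P γ (r (θ k ω))) :=
    measurable_logPolicy_softmaxPolicy fun s a => (measurable_optQ hr hγ0 hγ1 P s a).comp hθ
  refine Integrable.of_bound (h1.sub h2).norm.aestronglyMeasurable
    (policyError A γ C_r L_r α ε k) ?_
  filter_upwards [hrun.ae_logPolicy_error hr hγ0 hγ1 hα hε] with ω hω
  rw [norm_norm]
  exact hω k hk

include hα hε in
lemma IsRun.integral_logPolicy_error_le {k : ℕ} (hk : k < K) :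
    ∫ ω, ‖logPolicy (π (k + 1) ω) - logPolicy (optPolicy P γ (r (θ k ω)))‖ ∂μ
      ≤ policyError A γ C_r L_r α ε k := by
  refine (integral_mono_ae (hrun.integrable_logPolicy_error hr hγ0 hγ1 hα hε hk)
    (integrable_const (policyError A γ C_r L_r α ε k)) ?_).trans (by simp)
  filter_upwards [hrun.ae_logPolicy_error hr hγ0 hγ1 hα hε] with ω hω
  exact hω k hk

variable (hN : 0 < N)

omit [IsProbabilityMeasure μ] in
include hN in
lemma IsRun.measurable_surrogateGrad {k : ℕ} (hk : k ≤ K) :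
    Measurable[ℱ k] fun ω => surrogateGrad P ρ γ r D (θ k ω) := by
  -- Being a gradient, it is measurable in `θ` without inspecting its formula.
  have : surrogateGrad P ρ γ r D = gradient (surrogate P ρ γ r D) :=
    funext fun θ => (hasGradientAt_surrogate hr hγ0 hγ1 P ρ D hN θ).gradient.symm
  rw [this]
  exact (measurable_gradient _).comp (hrun.measurable_param hr hγ0 hγ1 hk)

include hN in
lemma IsRun.integrable_norm_sq_surrogateGrad {k : ℕ} (hk : k ≤ K) :
    Integrable (fun ω => ‖surrogateGrad P ρ γ r D (θ k ω)‖ ^ 2) μ := by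
  refine Integrable.of_bound (((hrun.measurable_surrogateGrad hr hγ0 hγ1 hN hk).mono (ℱ.le k)
    le_rfl).norm.pow_const 2).aestronglyMeasurable ((2 * (L_r / (1 - γ))) ^ 2)
    (Filter.Eventually.of_forall fun ω => ?_)
  rw [norm_pow, norm_norm]
  exact pow_le_pow_left₀ (norm_nonneg _) (norm_surrogateGrad_le hr hγ0 hγ1 P ρ D hN _) 2

include hN in
lemma IsRun.integrable_surrogate {k : ℕ} (hk : k ≤ K) :
    Integrable (fun ω => surrogate P ρ γ r D (θ k ω)) μ := by
  have hd : Differentiable ℝ (surrogate P ρ γ r D) := fun θ =>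
    (hasGradientAt_surrogate hr hγ0 hγ1 P ρ D hN θ).differentiableAt
  exact Integrable.of_bound (hd.continuous.measurable.comp
    ((hrun.measurable_param hr hγ0 hγ1 hk).mono (ℱ.le k) le_rfl)).aestronglyMeasurable _
    (Filter.Eventually.of_forall fun ω => abs_surrogate_le hr hγ0 hγ1 P ρ D hN _)

/-- The factor by which the policy error biases the ascent direction. -/
def biasConst (A : Type*) [Fintype A] (γ L_r : ℝ) : ℝ :=
  2 * (L_r / (1 - γ)) * (Fintype.card A * (L_r / (1 - γ)) / (1 - γ))

include hN hα hε in
/-- The stochastic direction is an approximate ascent direction in the mean. -/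
lemma IsRun.integral_inner_direction_ge {k : ℕ} (hk : k < K) :
    Integrable (fun ω => inner ℝ (surrogateGrad P ρ γ r D (θ k ω))
      (discountedGrad γ r (θ k ω) (D (I k ω)) - discountedGrad γ r (θ k ω) (τ k ω))) μ ∧
    ∫ ω, ‖surrogateGrad P ρ γ r D (θ k ω)‖ ^ 2 ∂μ
        - biasConst A γ L_r * policyError A γ C_r L_r α ε k
      ≤ ∫ ω, inner ℝ (surrogateGrad P ρ γ r D (θ k ω))
        (discountedGrad γ r (θ k ω) (D (I k ω)) - discountedGrad γ r (θ k ω) (τ k ω)) ∂μ := by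
  set v : Ω → Param p := fun ω => surrogateGrad P ρ γ r D (θ k ω) with hvdef
  have hg : 0 < 1 - γ := by linarith
  have hB : 0 ≤ L_r / (1 - γ) := div_nonneg hr.pos_L_r.le hg.le
  have hθ := hrun.measurable_param hr hγ0 hγ1 hk.le
  have hv : Measurable[ℱ k] v := hrun.measurable_surrogateGrad hr hγ0 hγ1 hN hk.le
  have hvb : ∀ ω, ‖v ω‖ ≤ 2 * (L_r / (1 - γ)) := fun ω =>
    norm_surrogateGrad_le hr hγ0 hγ1 P ρ D hN _
  have hI : Measurable (I k) := (hrun.expert_measurable k hk).mono (ℱ.le _) le_rfl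
  have hτ : Measurable (τ k) := (hrun.agent_measurable k hk).mono (ℱ.le _) le_rfl
  have hE := integral_eval_of_condExp (μ := μ) (c := 2 * (L_r / (1 - γ)) * (L_r / (1 - γ)))
    (ℱ.le k) (X := fun i ω => inner ℝ (v ω) (discountedGrad γ r (θ k ω) (D i)))
    (fun i => (Measurable.inner hv ((measurable_discountedGrad hr hγ0 hγ1).comp
      (hθ.prodMk measurable_const))).stronglyMeasurable)
    (fun i ω => (abs_real_inner_le_norm _ _).trans (mul_le_mul (hvb ω)
      (norm_discountedGrad_le hr hγ0 hγ1 _ _) (norm_nonneg _) (by positivity)))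
    hI (hrun.expert_law k hk)
  have hA := integral_discounted_of_condLaw (μ := μ) (c := 2 * (L_r / (1 - γ)) * L_r) hγ0 hγ1 P ρ
    (ℱ.le k) (X := fun ω s a => inner ℝ (v ω) (rewardGrad r (θ k ω) s a))
    (fun s a => (Measurable.inner hv ((measurable_rewardGrad r s a).comp hθ)).stronglyMeasurable)
    (fun ω s a => (abs_real_inner_le_norm _ _).trans (mul_le_mul (hvb ω)
      (hr.norm_gradient_le _ _ _) (norm_nonneg _) (by positivity)))
    hτ (hrun.agent_law k hk)
  have hsplit : (fun ω => inner ℝ (v ω) (discountedGrad γ r (θ k ω) (D (I k ω))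
        - discountedGrad γ r (θ k ω) (τ k ω)))
      = fun ω => inner ℝ (v ω) (discountedGrad γ r (θ k ω) (D (I k ω)))
        - ∑' t : ℕ, γ ^ t * inner ℝ (v ω) (rewardGrad r (θ k ω) (τ k ω t).1 (τ k ω t).2) := by
    funext ω
    rw [inner_sub_right]
    congr 1
    have h := (innerSL ℝ (v ω)).hasSum (hasSum_discountedGrad hr hγ0 hγ1 (θ k ω) (τ k ω))
    simp only [innerSL_apply_apply] at h
    rw [← h.tsum_eq]
    exact tsum_congr fun t => by simp [inner_smul_right]
  rw [hsplit]
  refine ⟨hE.1.sub hA.1, ?_⟩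
  rw [integral_sub hE.1 hA.1, hE.2.2, hA.2.2, ← integral_sub hE.2.1 hA.2.1, sub_le_iff_le_add]
  -- Given the history, the expert mean is `v` plus the agent mean under the optimal policy. The
  -- mean direction is therefore `v` plus the discrepancy of agent means between the optimal policy
  -- and `π_{k+1}`, which the policy error controls.
  have hbias : ∀ᵐ ω ∂μ, ‖v ω‖ ^ 2 ≤
      (∑ i, inner ℝ (v ω) (discountedGrad γ r (θ k ω) (D i)) * (1 / (N : ℝ))
        - avg ρ (val P γ (π (k + 1) ω) fun s a => inner ℝ (v ω) (rewardGrad r (θ k ω) s a)))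
      + biasConst A γ L_r * policyError A γ C_r L_r α ε k := by
    filter_upwards [hrun.ae_logPolicy_error hr hγ0 hγ1 hα hε] with ω hω
    have hlog : ∀ s a, |logPolicy (softmaxPolicy (optQ P γ (r (θ k ω)))) (s, a)
        - logPolicy (softmaxPolicy (Qhat k ω)) (s, a)| ≤ policyError A γ C_r L_r α ε k := by
      intro s a
      rw [← hrun.improvement k hk ω, abs_sub_comm]
      exact (norm_le_pi_norm (logPolicy (π (k + 1) ω)
        - logPolicy (optPolicy P γ (r (θ k ω)))) (s, a)).trans (hω k hk)
    have hpol := abs_softmaxPolicy_sub_le hlog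
    rw [← hrun.improvement k hk ω] at hpol
    have hval := norm_avg_le ρ fun s => norm_val_sub_val_le hγ0 hγ1 P
      (optPolicy P γ (r (θ k ω))) (rewardGrad r (θ k ω)) (π (k + 1) ω)
      (fun s a => hr.norm_gradient_le s a (θ k ω)) hpol s
    rw [avg_sub] at hval
    have h1 : ∑ i, inner ℝ (v ω) (discountedGrad γ r (θ k ω) (D i)) * (1 / (N : ℝ))
        = inner ℝ (v ω) ((1 / (N : ℝ)) • ∑ i, discountedGrad γ r (θ k ω) (D i)) := by
      rw [← Finset.sum_mul, inner_smul_right, inner_sum, mul_comm]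
    have h2 : avg ρ (val P γ (π (k + 1) ω) fun s a => inner ℝ (v ω) (rewardGrad r (θ k ω) s a))
        = inner ℝ (v ω) (avg ρ (val P γ (π (k + 1) ω) (rewardGrad r (θ k ω)))) := by
      rw [← avg_inner]
      exact congrArg (avg ρ) (funext fun s => val_inner hγ0 hγ1 P _ _ _ s)
    have h3 : (1 / (N : ℝ)) • ∑ i, discountedGrad γ r (θ k ω) (D i)
        = v ω + avg ρ (val P γ (optPolicy P γ (r (θ k ω))) (rewardGrad r (θ k ω))) := by
      simp only [hvdef, surrogateGrad, optGrad, sub_add_cancel]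
    rw [h1, h2, ← inner_sub_right, h3, add_sub_assoc, inner_add_right, real_inner_self_eq_norm_sq]
    have h4 := (abs_le.1 ((abs_real_inner_le_norm (v ω) _).trans (mul_le_mul (hvb ω) hval
      (norm_nonneg _) (by positivity)))).1
    have h5 : 2 * (L_r / (1 - γ)) * (Fintype.card A *
        (policyError A γ C_r L_r α ε k * (L_r / (1 - γ))) / (1 - γ))
        = biasConst A γ L_r * policyError A γ C_r L_r α ε k := by
      rw [biasConst]
      ring
    rw [h5] at h4
    linarith
  have hint := integral_mono_ae (hrun.integrable_norm_sq_surrogateGrad hr hγ0 hγ1 hN hk.le)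
    ((hE.2.1.sub hA.2.1).add (integrable_const _)) hbias
  refine hint.trans_eq ?_
  rw [integral_add' (hE.2.1.sub hA.2.1) (integrable_const _)]
  simp

include hN hα hε in
/-- The mean ascent in one iteration. -/
lemma IsRun.integral_ascent {k : ℕ} (hk : k < K) :
    α * ∫ ω, ‖surrogateGrad P ρ γ r D (θ k ω)‖ ^ 2 ∂μ
      ≤ (∫ ω, surrogate P ρ γ r D (θ (k + 1) ω) ∂μ - ∫ ω, surrogate P ρ γ r D (θ k ω) ∂μ)
        + α * (biasConst A γ L_r * policyError A γ C_r L_r α ε k)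
        + smoothConst A γ L_r L_g * stepBound γ L_r α ^ 2 := by
  obtain ⟨hint, hdir⟩ := hrun.integral_inner_direction_ge hr hγ0 hγ1 hα hε hN hk
  have hg : 0 < 1 - γ := by linarith
  have hsm : 0 ≤ smoothConst A γ L_r L_g := by
    have h1 := hr.pos_L_r
    have h2 := hr.pos_L_g
    unfold smoothConst
    positivity
  have hpt : ∀ ω, α * inner ℝ (surrogateGrad P ρ γ r D (θ k ω))
      (discountedGrad γ r (θ k ω) (D (I k ω)) - discountedGrad γ r (θ k ω) (τ k ω))
      ≤ (surrogate P ρ γ r D (θ (k + 1) ω) - surrogate P ρ γ r D (θ k ω))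
        + smoothConst A γ L_r L_g * stepBound γ L_r α ^ 2 := by
    intro ω
    have h1 := (abs_le.1 (abs_surrogate_remainder_le hr hγ0 hγ1 P ρ D hN (θ k ω)
      (θ (k + 1) ω))).1
    have h2 := mul_le_mul_of_nonneg_left (pow_le_pow_left₀ (norm_nonneg _)
      (hrun.norm_step_le hr hγ0 hγ1 hα hk ω) 2) hsm
    have h3 : θ (k + 1) ω - θ k ω = α • (discountedGrad γ r (θ k ω) (D (I k ω))
        - discountedGrad γ r (θ k ω) (τ k ω)) := by
      rw [hrun.update k hk, add_sub_cancel_left]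
    have h4 : inner ℝ (surrogateGrad P ρ γ r D (θ k ω)) (θ (k + 1) ω - θ k ω)
        = α * inner ℝ (surrogateGrad P ρ γ r D (θ k ω))
          (discountedGrad γ r (θ k ω) (D (I k ω)) - discountedGrad γ r (θ k ω) (τ k ω)) := by
      rw [h3, inner_smul_right]
    rw [h4] at h1
    linarith
  have h0 := hrun.integrable_surrogate hr hγ0 hγ1 hN hk.le
  have h1 := hrun.integrable_surrogate hr hγ0 hγ1 hN (k := k + 1) hk
  have hmono := integral_mono (hint.const_mul α) ((h1.sub h0).add (integrable_const _)) hpt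
  rw [integral_const_mul, integral_add' (h1.sub h0) (integrable_const _), integral_sub' h1 h0]
    at hmono
  simp only [integral_const, probReal_univ, one_smul] at hmono
  have := mul_le_mul_of_nonneg_left hdir hα
  linarith

end Run

/-! ### Averaging over the iterations. -/

section Averages

variable {S A : Type*} [Fintype S] [MeasurableSpace S] [DiscreteMeasurableSpace S]
variable [Fintype A] [Nonempty A] [MeasurableSpace A] [DiscreteMeasurableSpace A]
variable {p N : ℕ} {P : S → A → PMF S} {ρ : PMF S} {γ C_r L_r L_g : ℝ}

/-- The bound on the surrogate log-likelihood. -/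
def surrogateBound (A : Type*) [Fintype A] (γ C_r : ℝ) : ℝ :=
  C_r / (1 - γ) + valueBound A γ C_r

omit [Nonempty A] [MeasurableSpace A] [DiscreteMeasurableSpace A] in
lemma mean_policyError_le (hγ0 : 0 ≤ γ) (hγ1 : γ < 1) (hM : 0 ≤ valueBound A γ C_r)
    {α ε : ℝ} {K : ℕ} (hK : 1 ≤ K) :
    (1 / (K : ℝ)) * ∑ k ∈ Finset.range K, policyError A γ C_r L_r α ε k
      ≤ 4 * valueBound A γ C_r / (1 - γ) * (1 / (K : ℝ))
        + 2 * ε + 2 * iterError γ L_r α ε / (1 - γ) := by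
  have hK' : (0 : ℝ) < K := by exact_mod_cast hK
  have hgeom : ∑ k ∈ Finset.range K, γ ^ k ≤ (1 - γ)⁻¹ := by
    rw [← tsum_geometric_of_lt_one hγ0 hγ1]
    exact (summable_geometric_of_lt_one hγ0 hγ1).sum_le_tsum _ fun k _ => pow_nonneg hγ0 k
  have hsum : ∑ k ∈ Finset.range K, policyError A γ C_r L_r α ε k
      = 4 * valueBound A γ C_r * ∑ k ∈ Finset.range K, γ ^ k
        + K * (2 * ε + 2 * iterError γ L_r α ε / (1 - γ)) := by
    rw [Finset.mul_sum, ← nsmul_eq_mul, ← Finset.card_range K, ← Finset.sum_const,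
      Finset.card_range, ← Finset.sum_add_distrib]
    refine Finset.sum_congr rfl fun k _ => ?_
    rw [policyError]
    ring
  rw [hsum, mul_add, ← mul_assoc (1 / (K : ℝ)) (K : ℝ), one_div_mul_cancel hK'.ne', one_mul,
    add_assoc]
  refine add_le_add_left ?_ _
  calc 1 / (K : ℝ) * (4 * valueBound A γ C_r * ∑ k ∈ Finset.range K, γ ^ k)
      ≤ 1 / (K : ℝ) * (4 * valueBound A γ C_r * (1 - γ)⁻¹) := by gcongr
    _ = _ := by ring

variable {r : Param p → S → A → ℝ} {D : Fin N → Traj S A} {θ₀ : Param p} {π₀ : Policy S A}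
variable {α ε : ℝ} {K : ℕ} {Ω : Type*} [mΩ : MeasurableSpace Ω] {μ : Measure Ω}
variable {ℱ : Filtration ℕ mΩ} {θ : ℕ → Ω → Param p} {π : ℕ → Ω → Policy S A}
variable {Qhat : ℕ → Ω → S → A → ℝ} {I : ℕ → Ω → Fin N} {τ : ℕ → Ω → Traj S A}

/-- Summed over `k`, the mean ascent telescopes, and boundedness of the surrogate caps the total
gain. The rest is division by `K * α`. -/
lemma IsRun.mean_norm_sq_surrogateGrad_le [IsProbabilityMeasure μ]
    (hrun : IsRun P ρ γ r D θ₀ π₀ α ε K μ ℱ θ π Qhat I τ)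
    (hr : IsRegularReward r C_r L_r L_g) (hγ0 : 0 ≤ γ) (hγ1 : γ < 1)
    (hα : 0 < α) (hε : 0 ≤ ε) (hN : 0 < N) (hK : 1 ≤ K) :
    (1 / (K : ℝ)) * ∑ k ∈ Finset.range K, ∫ ω, ‖surrogateGrad P ρ γ r D (θ k ω)‖ ^ 2 ∂μ
      ≤ 2 * surrogateBound A γ C_r / (K * α)
        + biasConst A γ L_r
          * ((1 / (K : ℝ)) * ∑ k ∈ Finset.range K, policyError A γ C_r L_r α ε k)
        + smoothConst A γ L_r L_g * stepBound γ L_r α ^ 2 / α := by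
  have hK' : (0 : ℝ) < K := by exact_mod_cast hK
  have hsum := Finset.sum_le_sum fun k (hk : k ∈ Finset.range K) =>
    hrun.integral_ascent hr hγ0 hγ1 hα.le hε hN (Finset.mem_range.1 hk)
  rw [Finset.sum_add_distrib, Finset.sum_add_distrib,
    Finset.sum_range_sub fun k => ∫ ω, surrogate P ρ γ r D (θ k ω) ∂μ, ← Finset.mul_sum,
    ← Finset.mul_sum, ← Finset.mul_sum, Finset.sum_const, Finset.card_range, nsmul_eq_mul] at hsum
  have hb : ∀ k, |∫ ω, surrogate P ρ γ r D (θ k ω) ∂μ| ≤ surrogateBound A γ C_r := fun k => by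
    have h := norm_integral_le_of_norm_le_const (μ := μ) (C := surrogateBound A γ C_r)
      (f := fun ω => surrogate P ρ γ r D (θ k ω)) (Filter.Eventually.of_forall fun ω =>
        abs_surrogate_le hr hγ0 hγ1 P ρ D hN (θ k ω))
    rwa [probReal_univ, mul_one] at h
  have h1 := (abs_le.1 (hb K)).2
  have h2 := (abs_le.1 (hb 0)).1
  have h3 : α * ∑ k ∈ Finset.range K, ∫ ω, ‖surrogateGrad P ρ γ r D (θ k ω)‖ ^ 2 ∂μ
      ≤ 2 * surrogateBound A γ C_r
        + α * (biasConst A γ L_r * ∑ k ∈ Finset.range K, policyError A γ C_r L_r α ε k)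
        + K * (smoothConst A γ L_r L_g * stepBound γ L_r α ^ 2) := by linarith
  have h4 := mul_le_mul_of_nonneg_left h3 (show 0 ≤ 1 / (K * α) by positivity)
  calc (1 / (K : ℝ)) * ∑ k ∈ Finset.range K, ∫ ω, ‖surrogateGrad P ρ γ r D (θ k ω)‖ ^ 2 ∂μ
      = 1 / (K * α) * (α * ∑ k ∈ Finset.range K,
          ∫ ω, ‖surrogateGrad P ρ γ r D (θ k ω)‖ ^ 2 ∂μ) := by field_simp
    _ ≤ _ := h4
    _ = _ := by field_simp

end Averages

end

end MLIRL

/-- Finite-time convergence of approximate soft policy iteration alternated with stochastic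
gradient steps on the reward parameter. -/
theorem theorem1
    (S A : Type*) [Fintype S] [Nonempty S] [MeasurableSpace S] [DiscreteMeasurableSpace S]
    [Fintype A] [Nonempty A] [MeasurableSpace A] [DiscreteMeasurableSpace A]
    (γ : ℝ) (hγ0 : 0 ≤ γ) (hγ1 : γ < 1)
    (C_r L_r L_g : ℝ) (hC_r : 0 < C_r) (hL_r : 0 < L_r) (hL_g : 0 < L_g)
    (α₀ σ : ℝ) (hα₀ : 0 < α₀) (hσ0 : 0 < σ) (hσ1 : σ < 1) :
    ∃ C : ℝ, 0 < C ∧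
      ∀ (p N : ℕ) (P : S → A → PMF S) (ρ : PMF S) (D : Fin N → MLIRL.Traj S A)
        (r : MLIRL.Param p → S → A → ℝ),
        0 < N →
        (∀ θ s a, 0 ≤ r θ s a ∧ r θ s a ≤ C_r) →
        (∀ s a, Differentiable ℝ fun θ => r θ s a) →
        (∀ s a θ, ‖gradient (fun θ' => r θ' s a) θ‖ ≤ L_r) →
        (∀ s a θ₁ θ₂, ‖gradient (fun θ' => r θ' s a) θ₁ - gradient (fun θ' => r θ' s a) θ₂‖
          ≤ L_g * ‖θ₁ - θ₂‖) →
        -- the policy `π_θ` is optimal for the lower-level problem, from every initial state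
        (∀ θ (π : MLIRL.Policy S A) s,
          MLIRL.softV P γ (r θ) π s
            ≤ MLIRL.softV P γ (r θ) (MLIRL.optPolicy P γ (r θ)) s) ∧
        -- the surrogate likelihood is differentiable
        Differentiable ℝ (MLIRL.surrogate P ρ γ r D) ∧
        -- the bounds hold for every run
        ∀ (θ₀ : MLIRL.Param p) (π₀ : MLIRL.Policy S A) (ε : ℝ) (K : ℕ), 0 ≤ ε → 1 ≤ K →
        ∀ (Ω : Type*) [mΩ : MeasurableSpace Ω] (μ : Measure Ω) [IsProbabilityMeasure μ]
          (ℱ : Filtration ℕ mΩ) (θ : ℕ → Ω → MLIRL.Param p) (π : ℕ → Ω → MLIRL.Policy S A)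
          (Qhat : ℕ → Ω → S → A → ℝ) (I : ℕ → Ω → Fin N) (τ : ℕ → Ω → MLIRL.Traj S A),
          MLIRL.IsRun P ρ γ r D θ₀ π₀ (α₀ / (K : ℝ) ^ σ) ε K μ ℱ θ π Qhat I τ →
          (∀ k < K, Integrable (fun ω => ‖MLIRL.logPolicy (π (k + 1) ω)
            - MLIRL.logPolicy (MLIRL.optPolicy P γ (r (θ k ω)))‖) μ) ∧
          (∀ k < K, Integrable (fun ω =>
            ‖gradient (MLIRL.surrogate P ρ γ r D) (θ k ω)‖ ^ 2) μ) ∧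
          (1 / (K : ℝ)) * ∑ k ∈ Finset.range K,
              ∫ ω, ‖MLIRL.logPolicy (π (k + 1) ω)
                - MLIRL.logPolicy (MLIRL.optPolicy P γ (r (θ k ω)))‖ ∂μ
            ≤ C * ((K : ℝ) ^ (-1 : ℝ) + (K : ℝ) ^ (-σ) + ε) ∧
          (1 / (K : ℝ)) * ∑ k ∈ Finset.range K,
              ∫ ω, ‖gradient (MLIRL.surrogate P ρ γ r D) (θ k ω)‖ ^ 2 ∂μ
            ≤ C * ((K : ℝ) ^ (-σ) + (K : ℝ) ^ (-1 + σ) + (K : ℝ) ^ (-1 : ℝ) + ε) ∧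
          (σ = 1 / 2 →
            (1 / (K : ℝ)) * ∑ k ∈ Finset.range K,
                ∫ ω, ‖MLIRL.logPolicy (π (k + 1) ω)
                  - MLIRL.logPolicy (MLIRL.optPolicy P γ (r (θ k ω)))‖ ∂μ
              ≤ C * ((K : ℝ) ^ (-(1 / 2) : ℝ) + ε) ∧
            (1 / (K : ℝ)) * ∑ k ∈ Finset.range K,
                ∫ ω, ‖gradient (MLIRL.surrogate P ρ γ r D) (θ k ω)‖ ^ 2 ∂μ
              ≤ C * ((K : ℝ) ^ (-(1 / 2) : ℝ) + ε)) := by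
  have hg : 0 < 1 - γ := by linarith
  have hlog : 0 ≤ Real.log (Fintype.card A) :=
    Real.log_nonneg (by exact_mod_cast Fintype.card_pos)
  have hM : 0 ≤ MLIRL.valueBound A γ C_r := by
    unfold MLIRL.valueBound
    positivity
  have hLb : 0 ≤ MLIRL.surrogateBound A γ C_r := by
    unfold MLIRL.surrogateBound
    positivity
  have hG : 0 ≤ MLIRL.biasConst A γ L_r := by
    unfold MLIRL.biasConst
    positivity
  have hΛ : 0 ≤ MLIRL.smoothConst A γ L_r L_g := by
    unfold MLIRL.smoothConst
    positivity
  set M := MLIRL.valueBound A γ C_r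
  set G := MLIRL.biasConst A γ L_r
  set Lb := MLIRL.surrogateBound A γ C_r
  set Λ := MLIRL.smoothConst A γ L_r L_g
  set B := L_r / (1 - γ) with hB
  have hB0 : 0 < B := div_pos hL_r hg
  -- `a₁, a₂, a₃` are the coefficients of `1/K`, `K ^ (-σ)` and `ε` in the mean policy error. `b₁,
  -- b₂` belong to the telescoped gain and the quadratic remainder. All are fixed before the
  -- dimension, data set, kernel and reward.
  obtain ⟨a₁, ha₁⟩ : ∃ a₁, a₁ = 4 * M / (1 - γ) := ⟨_, rfl⟩
  obtain ⟨a₂, ha₂⟩ : ∃ a₂, a₂ = 8 * B ^ 2 * α₀ / (1 - γ) := ⟨_, rfl⟩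
  obtain ⟨a₃, ha₃⟩ : ∃ a₃, a₃ = 2 + 4 / (1 - γ) ^ 2 := ⟨_, rfl⟩
  obtain ⟨b₁, hb₁⟩ : ∃ b₁, b₁ = 2 * Lb / α₀ := ⟨_, rfl⟩
  obtain ⟨b₂, hb₂⟩ : ∃ b₂, b₂ = Λ * (4 * B ^ 2) * α₀ := ⟨_, rfl⟩
  have ha₁0 : 0 ≤ a₁ := by rw [ha₁]; positivity
  have ha₂0 : 0 ≤ a₂ := by rw [ha₂]; positivity
  have ha₃0 : 0 < a₃ := by rw [ha₃]; positivity
  have hb₁0 : 0 ≤ b₁ := by rw [hb₁]; positivity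
  have hb₂0 : 0 ≤ b₂ := by rw [hb₂]; positivity
  obtain ⟨c₁, hc₁⟩ : ∃ c₁, c₁ = a₁ + a₂ + a₃ := ⟨_, rfl⟩
  obtain ⟨c₂, hc₂⟩ : ∃ c₂, c₂ = b₁ + G * c₁ + b₂ := ⟨_, rfl⟩
  have hc₁0 : 0 < c₁ := by rw [hc₁]; positivity
  have hc₂0 : 0 ≤ c₂ := by rw [hc₂]; positivity
  -- The factor `3` serves only `σ = 1/2`, where `K ^ (-σ) = K ^ (-1 + σ) ≥ 1/K` and the sums of
  -- powers collapse to one term.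
  refine ⟨3 * (c₁ + c₂), by positivity, ?_⟩
  intro p N P ρ D r hN hrb hrd hrg hrl
  have hr : MLIRL.IsRegularReward r C_r L_r L_g := ⟨hrb, hrd, hrg, hrl, hL_r, hL_g⟩
  have hgrad := MLIRL.hasGradientAt_surrogate hr hγ0 hγ1 P ρ D hN
  refine ⟨fun θ π s => ?_, fun θ => (hgrad θ).differentiableAt, ?_⟩
  · rw [MLIRL.softV_optPolicy P hγ0 hγ1]
    exact MLIRL.softV_le_optV P hγ0 hγ1 _ π s
  intro θ₀ π₀ ε K hε hK Ω mΩ μ _ ℱ θ π Qhat I τ hrun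
  have hK' : (0 : ℝ) < K := by exact_mod_cast hK
  have hK1 : (1 : ℝ) ≤ K := by exact_mod_cast hK
  have hα : 0 < α₀ / (K : ℝ) ^ σ := by positivity
  obtain ⟨x, hx⟩ : ∃ x, x = (K : ℝ) ^ (-σ) := ⟨_, rfl⟩
  obtain ⟨y, hy⟩ : ∃ y, y = (K : ℝ) ^ (-1 + σ) := ⟨_, rfl⟩
  obtain ⟨z, hz⟩ : ∃ z, z = (K : ℝ) ^ (-1 : ℝ) := ⟨_, rfl⟩
  have hx0 : 0 < x := by rw [hx]; positivity
  have hy0 : 0 < y := by rw [hy]; positivity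
  have hz0 : 0 < z := by rw [hz]; positivity
  have hzK : 1 / (K : ℝ) = z := by rw [hz, Real.rpow_neg_one, one_div]
  have hαx : α₀ / (K : ℝ) ^ σ = α₀ * x := by rw [hx, Real.rpow_neg hK'.le, div_eq_mul_inv]
  have hxy : x * y = z := by
    rw [hx, hy, hz, ← Real.rpow_add hK']
    congr 1
    ring
  have hmean : (1 / (K : ℝ)) * ∑ k ∈ Finset.range K,
      MLIRL.policyError A γ C_r L_r (α₀ / (K : ℝ) ^ σ) ε k ≤ c₁ * (z + x + ε) := by
    refine (MLIRL.mean_policyError_le hγ0 hγ1 hM hK).trans ?_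
    have h1 : 4 * M / (1 - γ) * (1 / (K : ℝ)) + 2 * ε
        + 2 * MLIRL.iterError γ L_r (α₀ / (K : ℝ) ^ σ) ε / (1 - γ)
        = a₁ * z + a₂ * x + a₃ * ε := by
      rw [hzK, hαx, MLIRL.iterError, MLIRL.stepBound, ha₁, ha₂, ha₃, hB]
      field_simp
      ring
    rw [h1, hc₁]
    nlinarith [mul_nonneg ha₁0 hx0.le, mul_nonneg ha₁0 hε, mul_nonneg ha₂0 hz0.le,
      mul_nonneg ha₂0 hε, mul_nonneg ha₃0.le hz0.le, mul_nonneg ha₃0.le hx0.le]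
  have hfst : (1 / (K : ℝ)) * ∑ k ∈ Finset.range K,
      ∫ ω, ‖MLIRL.logPolicy (π (k + 1) ω)
        - MLIRL.logPolicy (MLIRL.optPolicy P γ (r (θ k ω)))‖ ∂μ ≤ c₁ * (z + x + ε) :=
    (mul_le_mul_of_nonneg_left (Finset.sum_le_sum fun k hk =>
      hrun.integral_logPolicy_error_le hr hγ0 hγ1 hα.le hε (Finset.mem_range.1 hk))
      (by positivity)).trans hmean
  have hsnd : (1 / (K : ℝ)) * ∑ k ∈ Finset.range K,
      ∫ ω, ‖gradient (MLIRL.surrogate P ρ γ r D) (θ k ω)‖ ^ 2 ∂μ ≤ c₂ * (x + y + z + ε) := by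
    simp_rw [fun θ => (hgrad θ).gradient]
    refine (hrun.mean_norm_sq_surrogateGrad_le hr hγ0 hγ1 hα hε hN hK).trans ?_
    have h1 : 2 * Lb / (K * (α₀ / (K : ℝ) ^ σ)) = b₁ * y := by
      rw [hαx, hb₁]
      have hKz : (K : ℝ) = 1 / z := by rw [← hzK, one_div_one_div]
      rw [hKz, ← hxy]
      field_simp
    have h2 : Λ * MLIRL.stepBound γ L_r (α₀ / (K : ℝ) ^ σ) ^ 2 / (α₀ / (K : ℝ) ^ σ) = b₂ * x := by
      rw [hαx, hb₂, MLIRL.stepBound, ← hB]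
      field_simp
      ring
    have h3 := mul_le_mul_of_nonneg_left hmean hG
    have h4 : G * (c₁ * (z + x + ε)) ≤ G * c₁ * (x + y + z + ε) := by
      rw [← mul_assoc]
      exact mul_le_mul_of_nonneg_left (by linarith) (by positivity)
    have h5 : b₁ * y ≤ b₁ * (x + y + z + ε) := mul_le_mul_of_nonneg_left (by linarith) hb₁0
    have h6 : b₂ * x ≤ b₂ * (x + y + z + ε) := mul_le_mul_of_nonneg_left (by linarith) hb₂0
    rw [h1, h2, hc₂]
    linarith
  rw [← hx, ← hy, ← hz]
  refine ⟨fun k hk => hrun.integrable_logPolicy_error hr hγ0 hγ1 hα.le hε hk, fun k hk => ?_,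
    hfst.trans (mul_le_mul_of_nonneg_right (by linarith) (by linarith)),
    hsnd.trans (mul_le_mul_of_nonneg_right (by linarith) (by linarith)), fun hσ => ?_⟩
  · simp_rw [fun θ => (hgrad θ).gradient]
    exact hrun.integrable_norm_sq_surrogateGrad hr hγ0 hγ1 hN hk.le
  · have hw : (K : ℝ) ^ (-(1 / 2) : ℝ) = x := by rw [hx, hσ]
    have hyx : y = x := by
      rw [hy, hx, hσ]
      norm_num
    have hzx : z ≤ x := by
      rw [hz, hx]
      exact Real.rpow_le_rpow_of_exponent_le hK1 (by linarith)
    rw [hw]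
    constructor
    · calc _ ≤ c₁ * (z + x + ε) := hfst
        _ ≤ c₁ * (3 * (x + ε)) := mul_le_mul_of_nonneg_left (by linarith) hc₁0.le
        _ = 3 * c₁ * (x + ε) := by ring
        _ ≤ _ := mul_le_mul_of_nonneg_right (by linarith) (by linarith)
    · calc _ ≤ c₂ * (x + y + z + ε) := hsnd
        _ ≤ c₂ * (3 * (x + ε)) := mul_le_mul_of_nonneg_left (by linarith) hc₂0
        _ = 3 * c₂ * (x + ε) := by ring
        _ ≤ _ := mul_le_mul_of_nonneg_right (by linarith) (by linarith)
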